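/- Let $k$ be a number field and let $\varepsilon>0$. There is a constant $C=C(k,\varepsilon)>0$ such that for every squarefree integral ideal $\mathfrak q$ of $\mathcal O_k$ and every real $X>0$, the number of $k$-isomorphism classes of non-cyclic cubic extensions $K/k$ that are partially ramified at every prime $\mathfrak p\mid\mathfrak q$ (that is, $\mathfrak p\mathcal O_K=\mathfrak P_1^2\mathfrak P_2$ with distinct primes $\mathfrak P_1,\mathfrak P_2$ of $\mathcal O_K$) and whose absolute discriminant satisfies $|\mathrm{disc}(K/\mathbb Q)|\le X$ is finite and at most $$C\,\frac{X}{|\mathfrak q|^{1/6-\varepsilon}},$$ where $|\mathfrak q|=N_{k/\mathbb Q}(\mathfrak q)$ is the absolute norm. The constant $C$ does not depend on $\mathfrak q$ or $X$. -/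

import Mathlib

open NumberField

/-- The extension `K / k` is cyclic: it is Galois with cyclic Galois group. -/
def IsCyclicExtension (k K : Type*) [Field k] [Field K] [Algebra k K] : Prop :=
  IsGalois k K ∧ IsCyclic (K ≃ₐ[k] K)

/-- A prime `p` of `k` is partially ramified in the cubic extension `K / k`:
`p 𝓞_K = P₁² P₂` with distinct primes `P₁`, `P₂` of `K`. -/
def IsPartiallyRamified (k K : Type*) [Field k] [Field K] [Algebra k K]
    (p : Ideal (𝓞 k)) : Prop :=
  ∃ P₁ P₂ : Ideal (𝓞 K), P₁.IsPrime ∧ P₂.IsPrime ∧ P₁ ≠ P₂ ∧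
    p.map (algebraMap (𝓞 k) (𝓞 K)) = P₁ ^ 2 * P₂

/-- The cubic extensions of `k` inside its algebraic closure. -/
abbrev CubicExtension (k : Type*) [Field k] : Type _ :=
  {K : IntermediateField k (AlgebraicClosure k) // Module.finrank k K = 3}

instance CubicExtension.instNumberField {k : Type*} [Field k] [NumberField k]
    (K : CubicExtension k) : NumberField K.1 :=
  have : FiniteDimensional k K.1 := Module.finite_of_finrank_pos (by rw [K.2]; norm_num)
  NumberField.of_module_finite k K.1

/-- Two cubic extensions of `k` are identified when they are isomorphic over `k`. -/
instance CubicExtension.instSetoid (k : Type*) [Field k] : Setoid (CubicExtension k) where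
  r K L := Nonempty (K.1 ≃ₐ[k] L.1)
  iseqv :=
    { refl := fun _ => ⟨AlgEquiv.refl⟩
      symm := fun ⟨e⟩ => ⟨e.symm⟩
      trans := fun ⟨e⟩ ⟨f⟩ => ⟨e.trans f⟩ }

/-- The set of `k`-isomorphism classes of non-cyclic cubic extensions `K / k` that are partially
ramified at every prime dividing `q` and have absolute discriminant `|disc (K / ℚ)| ≤ X`. -/
def partiallyRamifiedCubicClasses (k : Type*) [Field k] [NumberField k]
    (q : Ideal (𝓞 k)) (X : ℝ) : Set (Quotient (CubicExtension.instSetoid k)) :=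
  (fun K => Quotient.mk (CubicExtension.instSetoid k) K) ''
    {K : CubicExtension k | ¬ IsCyclicExtension k K.1 ∧
      (∀ p : Ideal (𝓞 k), p.IsPrime → p ∣ q → IsPartiallyRamified k K.1 p) ∧
      |(NumberField.discr K.1 : ℝ)| ≤ X}

/-!
Let `n = [k : ℚ]`. A cubic extension `K / k` has a reduced basis `1, α, β` whose houses
`1 ≤ x ≤ y` satisfy `(x y) ^ n ≪ |disc (K / ℚ)| ^ (1 / 2)`. The Delone–Faddeev correspondence
turns this basis into a cubic form over `𝓞 k` whose coefficients `(a, b, c, d)` have houses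
`≪ (x ^ 2 / y, x, y, y ^ 2 / x)`, and the translates of the form by `m ∈ 𝓞 k` of house `≪ y / x`
stay in a box of the same shape. So `K` accounts for `≫ (y / x) ^ n` forms of its box, and
nonisomorphic extensions account for disjoint sets of forms.

If `p ∤ 3` ramifies in `K`, then `p` divides `a` or the discriminant of the form. The discriminant
is quadratic in `d` with leading coefficient `-27 a ^ 2`, so once `a, b, c` are fixed, `d` lies in
at most two classes modulo each `p ∣ q` with `p ∤ 3 a`. Counting the forms box by box and summing
over dyadic `x` and `y` gives `≪ |q| ^ ε (X ^ (3 / 4) + X / |q|)` extensions. Finally `|q| ≪ X` as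
soon as there is one such extension, which makes this `≪ X / |q| ^ (1 / 4 - ε)`.
-/

/-! ### Houses of algebraic numbers -/

section House

open Module

variable {F : Type*} [Field F] [NumberField F]

theorem house_neg (x : F) : house (-x) = house x := by
  rw [house, house, map_neg, norm_neg]

theorem house_sub_le (x y : F) : house (x - y) ≤ house x + house y := by
  rw [sub_eq_add_neg, ← house_neg y]
  exact house_add_le x (-y)

theorem house_algebraMap_le {k K : Type*} [Field k] [NumberField k] [Field K] [NumberField K]
    [Algebra k K] (x : k) : house (algebraMap k K x) ≤ house x := by
  rw [house, canonicalEmbedding.norm_le_iff]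
  exact fun σ => norm_embedding_le_house x (σ.comp (algebraMap k K))

open scoped Classical in
theorem house_eq_norm_mixedEmbedding (x : F) : house x = ‖mixedEmbedding F x‖ := by
  refine le_antisymm ?_ ?_
  · rw [house, canonicalEmbedding.norm_le_iff]
    intro φ
    rw [← InfinitePlace.apply φ x, mixedEmbedding.norm_eq_sup'_normAtPlace,
      ← mixedEmbedding.normAtPlace_apply]
    exact Finset.le_sup' (fun w => mixedEmbedding.normAtPlace w (mixedEmbedding F x))
      (Finset.mem_univ _)
  · rw [mixedEmbedding.norm_eq_sup'_normAtPlace]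
    refine Finset.sup'_le _ _ fun w _ => ?_
    rw [mixedEmbedding.normAtPlace_apply, ← InfinitePlace.norm_embedding_eq]
    exact norm_embedding_le_house x w.embedding

theorem one_le_house {x : 𝓞 F} (hx : x ≠ 0) : 1 ≤ house (x : F) :=
  one_le_house_of_isIntegral x.2 (RingOfIntegers.coe_ne_zero_iff.2 hx)

theorem abs_norm_le_house_pow (x : F) : |(Algebra.norm ℚ x : ℝ)| ≤ house x ^ finrank ℚ F := by
  obtain ⟨σ⟩ : Nonempty (F →+* ℂ) := inferInstance
  have h := norm_norm_le_norm_mul_house_pow x σ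
  rw [← Rat.norm_cast_real, Real.norm_eq_abs] at h
  calc |(Algebra.norm ℚ x : ℝ)| ≤ ‖σ x‖ * house x ^ (finrank ℚ F - 1) := h
    _ ≤ house x * house x ^ (finrank ℚ F - 1) :=
        mul_le_mul_of_nonneg_right (norm_embedding_le_house x σ) (pow_nonneg (house_nonneg x) _)
    _ = house x ^ finrank ℚ F := mul_pow_sub_one finrank_pos.ne' _

theorem absNorm_le_house_pow {I : Ideal (𝓞 F)} {x : 𝓞 F} (hx : x ∈ I) (h0 : x ≠ 0) :
    (Ideal.absNorm I : ℝ) ≤ house (x : F) ^ finrank ℚ F := by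
  have hdvd : Ideal.absNorm I ∣ (Algebra.norm ℤ x).natAbs := by
    rw [← Ideal.absNorm_span_singleton]
    exact Ideal.absNorm_dvd_absNorm_of_le ((Ideal.span_singleton_le_iff_mem I).2 hx)
  have hle : (Ideal.absNorm I : ℝ) ≤ (Algebra.norm ℤ x).natAbs := by
    exact_mod_cast Nat.le_of_dvd (Int.natAbs_pos.2 (Algebra.norm_ne_zero_iff.2 h0)) hdvd
  rw [Nat.cast_natAbs, Int.cast_abs] at hle
  refine hle.trans ?_
  simpa [← Algebra.coe_norm_int] using abs_norm_le_house_pow (x : F)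

theorem finite_setOf_house_le (F : Type*) [Field F] [NumberField F] (R : ℝ) :
    {x : 𝓞 F | house (x : F) ≤ R}.Finite := by
  refine Set.Finite.of_finite_image (f := ((↑) : 𝓞 F → F)) ?_
    RingOfIntegers.coe_injective.injOn
  refine (Embeddings.finite_of_norm_le F ℂ R).subset ?_
  rintro _ ⟨x, hx, rfl⟩
  exact ⟨x.2, fun φ => (norm_embedding_le_house _ φ).trans hx⟩

theorem finite_setOf_house_lt (F : Type*) [Field F] [NumberField F] (R : ℝ) :
    {x : 𝓞 F | house (x : F) < R}.Finite :=
  (finite_setOf_house_le F R).subset fun _ => le_of_lt (α := ℝ)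

theorem exists_forall_house_lt_imp_not {P : 𝓞 F → Prop} (hP : ∃ x, P x) :
    ∃ x, P x ∧ ∀ y : 𝓞 F, house (y : F) < house (x : F) → ¬ P y := by
  obtain ⟨x₀, hx₀⟩ := hP
  obtain ⟨x, ⟨hxx₀, hx⟩, hmin⟩ := Set.exists_min_image
    ({x : 𝓞 F | house (x : F) ≤ house (x₀ : F)} ∩ {x | P x}) (fun x : 𝓞 F => house (x : F))
    ((finite_setOf_house_le F _).inter_of_left _) ⟨x₀, le_refl (house (x₀ : F)), hx₀⟩
  exact ⟨x, hx, fun y hyx hy => (hmin y ⟨hyx.le.trans hxx₀, hy⟩).not_gt hyx⟩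

end House

/-! ### Counting in lattices -/

section LatticeCounting

open MeasureTheory Module

theorem card_le_mul_pow_finrank_of_norm_le {E ι : Type*} [NormedAddCommGroup E] [NormedSpace ℝ E]
    [FiniteDimensional ℝ E] (s : Finset ι) (f : ι → E) {R δ : ℝ} (M : ℕ) (hR : 0 ≤ R) (hδ : 0 < δ)
    (hs : ∀ i ∈ s, ‖f i‖ ≤ R)
    (hM : ∀ t ⊆ s, (∀ i ∈ t, ∀ j ∈ t, ‖f i - f j‖ < δ) → t.card ≤ M) :
    (s.card : ℝ) ≤ M * (1 + 2 * R / δ) ^ finrank ℝ E := by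
  classical
  borelize E
  let μ : Measure E := Measure.addHaar
  have hδ2 : 0 < δ / 2 := by positivity
  have hRδ : 0 < R + δ / 2 := by positivity
  -- the balls of radius `δ / 2` around the points cover no point more than `M` times
  have hmult (x : E) : ∑ i ∈ s, (Metric.ball (f i) (δ / 2)).indicator 1 x ≤
      (Metric.ball (0 : E) (R + δ / 2)).indicator (fun _ => (M : ENNReal)) x := by
    simp only [Set.indicator_apply, Pi.one_apply, Finset.sum_boole, Metric.mem_ball,
      dist_zero_right]
    split_ifs with hx
    · refine Nat.cast_le.2 (hM _ (Finset.filter_subset _ _) fun i hi j hj => ?_)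
      rw [← dist_eq_norm]
      linarith [dist_triangle_left (f i) (f j) x, (Finset.mem_filter.1 hi).2,
        (Finset.mem_filter.1 hj).2]
    · refine le_of_eq (Nat.cast_eq_zero.2 (Finset.card_eq_zero.2 (Finset.filter_eq_empty_iff.2 ?_)))
      intro i hi hxi
      rw [dist_eq_norm] at hxi
      linarith [norm_le_insert' x (f i), hs i hi]
  have hvol : s.card * ENNReal.ofReal ((δ / 2) ^ finrank ℝ E) * μ (Metric.ball 0 1) ≤
      M * ENNReal.ofReal ((R + δ / 2) ^ finrank ℝ E) * μ (Metric.ball 0 1) :=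
    calc s.card * ENNReal.ofReal ((δ / 2) ^ finrank ℝ E) * μ (Metric.ball 0 1)
        = ∑ i ∈ s, μ (Metric.ball (f i) (δ / 2)) := by
          simp only [μ.addHaar_ball_of_pos _ hδ2, Finset.sum_const, nsmul_eq_mul, mul_assoc]
      _ = ∫⁻ x, ∑ i ∈ s, (Metric.ball (f i) (δ / 2)).indicator 1 x ∂μ := by
          rw [lintegral_finsetSum _ fun i _ => measurable_one.indicator measurableSet_ball]
          simp only [lintegral_indicator_one measurableSet_ball]
      _ ≤ ∫⁻ x, (Metric.ball (0 : E) (R + δ / 2)).indicator (fun _ => (M : ENNReal)) x ∂μ :=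
          lintegral_mono hmult
      _ = M * ENNReal.ofReal ((R + δ / 2) ^ finrank ℝ E) * μ (Metric.ball 0 1) := by
          rw [lintegral_indicator_const measurableSet_ball, μ.addHaar_ball_of_pos _ hRδ, mul_assoc]
  rw [ENNReal.mul_le_mul_iff_left (Metric.measure_ball_pos _ _ one_pos).ne' measure_ball_lt_top.ne,
    ← ENNReal.ofReal_natCast, ← ENNReal.ofReal_natCast, ← ENNReal.ofReal_mul (by positivity),
    ← ENNReal.ofReal_mul (by positivity), ENNReal.ofReal_le_ofReal_iff (by positivity)] at hvol
  rw [show 1 + 2 * R / δ = (R + δ / 2) / (δ / 2) by field_simp; ring, div_pow, mul_div_assoc',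
    le_div_iff₀ (by positivity)]
  exact hvol

variable {F : Type*} [Field F] [NumberField F]

theorem finrank_span_canonicalEmbedding_le (V : Submodule ℚ F) :
    finrank ℝ (Submodule.span ℝ (canonicalEmbedding F '' V)) ≤ finrank ℚ V := by
  let b := finBasis ℚ V
  let f : Fin (finrank ℚ V) → (F →+* ℂ) → ℂ := fun i => canonicalEmbedding F (b i)
  have hspan : Submodule.span ℝ (canonicalEmbedding F '' V) ≤ Submodule.span ℝ (Set.range f) := by
    refine Submodule.span_le.2 ?_
    rintro _ ⟨x, hx, rfl⟩
    have hsum : canonicalEmbedding F x = ∑ i, (b.repr ⟨x, hx⟩ i : ℝ) • f i := by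
      have hx' : x = ∑ i, b.repr ⟨x, hx⟩ i • (b i : F) := by
        simpa only [Submodule.coe_sum, Submodule.coe_smul] using
          congrArg Subtype.val (b.sum_repr ⟨x, hx⟩).symm
      ext φ
      conv_lhs => rw [hx']
      simp [f, Algebra.smul_def, canonicalEmbedding.apply_at]
    rw [hsum]
    exact Submodule.sum_mem _ fun i _ =>
      Submodule.smul_mem _ _ (Submodule.subset_span (Set.mem_range_self i))
  calc _ ≤ finrank ℝ (Submodule.span ℝ (Set.range f)) := Submodule.finrank_mono hspan
    _ ≤ finrank ℚ V := (finrank_range_le_card f).trans_eq (Fintype.card_fin _)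

theorem card_le_mul_pow_finrank_of_house_le {ι : Type*} (V : Submodule ℚ F) (s : Finset ι)
    (f : ι → F) {R δ : ℝ} (M : ℕ) (hR : 0 ≤ R) (hδ : 0 < δ) (hV : ∀ i ∈ s, f i ∈ V)
    (hs : ∀ i ∈ s, house (f i) ≤ R)
    (hM : ∀ t ⊆ s, (∀ i ∈ t, ∀ j ∈ t, house (f i - f j) < δ) → t.card ≤ M) :
    (s.card : ℝ) ≤ M * (1 + 2 * R / δ) ^ finrank ℚ V := by
  let W := Submodule.span ℝ (canonicalEmbedding F '' V)
  let g : s → W := fun i => ⟨canonicalEmbedding F (f i),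
    Submodule.subset_span (Set.mem_image_of_mem _ (hV i i.2))⟩
  have hcard := card_le_mul_pow_finrank_of_norm_le Finset.univ g M hR hδ (fun i _ => hs i i.2)
    (fun t _ ht => by
      rw [← t.card_map (Function.Embedding.subtype _)]
      refine hM _ (by intro i; simp +contextual) fun i hi j hj => ?_
      obtain ⟨i, hit, rfl⟩ := Finset.mem_map.1 hi
      obtain ⟨j, hjt, rfl⟩ := Finset.mem_map.1 hj
      rw [house, map_sub]
      exact ht i hit j hjt)
  rw [Finset.card_univ, Fintype.card_coe] at hcard
  refine hcard.trans (mul_le_mul_of_nonneg_left ?_ (Nat.cast_nonneg M))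
  refine pow_le_pow_right₀ ?_ (finrank_span_canonicalEmbedding_le V)
  have : 0 ≤ 2 * R / δ := by positivity
  linarith

theorem measure_le_mul_of_encard_le {E L : Type*} [MeasurableSpace E] [AddGroup L] [Countable L]
    [AddAction L E] [MeasurableConstVAdd L E] {μ : Measure E} [VAddInvariantMeasure L E μ]
    {D S : Set E} (hD : IsAddFundamentalDomain L D μ) (hS : MeasurableSet S) (M : ℕ)
    (hM : ∀ x : E, {g : L | g +ᵥ x ∈ S}.encard ≤ M) : μ S ≤ M * μ D := by
  have hmeas (g : L) : AEMeasurable (fun x => S.indicator (1 : E → ENNReal) (g +ᵥ x))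
      (μ.restrict D) :=
    ((measurable_one.indicator hS).comp (measurable_const_vadd g)).aemeasurable
  have hmult (x : E) : ∑' g : L, S.indicator (1 : E → ENNReal) (g +ᵥ x) ≤ M := by
    have hind : (fun g : L => S.indicator (1 : E → ENNReal) (g +ᵥ x)) =
        {g : L | g +ᵥ x ∈ S}.indicator 1 := rfl
    rw [hind, ← tsum_subtype]
    simpa only [Pi.one_apply, ENNReal.tsum_set_one, ENat.toENNReal_coe] using
      ENat.toENNReal_le.2 (hM x)
  calc μ S = ∫⁻ x in D, ∑' g : L, S.indicator 1 (g +ᵥ x) ∂μ := by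
        rw [← lintegral_indicator_one hS, hD.lintegral_eq_tsum'', lintegral_tsum hmeas]
    _ ≤ ∫⁻ _ in D, (M : ENNReal) ∂μ := lintegral_mono hmult
    _ = M * μ D := setLIntegral_const D M

open mixedEmbedding Classical in
theorem encard_integerLattice_vadd_mem_ball_le (x : mixedSpace F) (r : ℝ) :
    {g : mixedEmbedding.integerLattice F | g +ᵥ x ∈ Metric.ball 0 r}.encard ≤
      {y : 𝓞 F | house (y : F) < 2 * r}.ncard := by
  rw [(finite_setOf_house_lt F _).cast_ncard_eq]
  rcases Set.eq_empty_or_nonempty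
    {g : mixedEmbedding.integerLattice F | g +ᵥ x ∈ Metric.ball 0 r} with hempty | ⟨g₀, hg₀⟩
  · rw [hempty, Set.encard_empty]
    exact zero_le
  have hex (g : mixedEmbedding.integerLattice F) :
      ∃ y : 𝓞 F, mixedEmbedding F y = (g - g₀ : mixedSpace F) := by
    obtain ⟨y, hy⟩ := (g - g₀).2
    exact ⟨y, hy⟩
  choose y hy using hex
  have hinj : Function.Injective y := fun g g' h =>
    Subtype.ext (sub_left_injective ((hy g).symm.trans (h ▸ hy g')))
  rw [← hinj.encard_image]
  refine Set.encard_le_encard (Set.image_subset_iff.2 fun g hg => ?_)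
  rw [Set.mem_preimage, Set.mem_ofPred_eq, house_eq_norm_mixedEmbedding, hy]
  rw [Set.mem_ofPred_eq, Submodule.vadd_def, vadd_eq_add, mem_ball_zero_iff] at hg hg₀
  calc ‖(g - g₀ : mixedSpace F)‖ = ‖(g + x) - (g₀ + x)‖ := by rw [add_sub_add_right_eq_sub]
    _ ≤ ‖(g + x : mixedSpace F)‖ + ‖g₀ + x‖ := norm_sub_le _ _
    _ < 2 * r := by linarith

open mixedEmbedding Classical in
theorem ofReal_pow_finrank_le_volume_ball {r : ℝ} (hr : 0 < r) :
    ENNReal.ofReal (r ^ finrank ℚ F) ≤ volume (Metric.ball (0 : mixedSpace F) r) := by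
  lift r to NNReal using hr.le
  have hball : Metric.ball (0 : mixedSpace F) r = convexBodyLT F fun _ => r := by
    rw [convexBodyLT, Prod.zero_eq_mk, ← ball_prod_same, ball_pi _ hr, ball_pi _ hr]
    rfl
  have hprod : ∏ w : InfinitePlace F, r ^ w.mult = r ^ finrank ℚ F := by
    rw [Finset.prod_pow_eq_pow_sum, InfinitePlace.sum_mult_eq]
  rw [hball, convexBodyLT_volume, hprod, ← NNReal.coe_pow, ENNReal.ofReal_coe_nnreal]
  exact le_mul_of_one_le_left zero_le (by exact_mod_cast one_le_convexBodyLTFactor F)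

open mixedEmbedding Classical in
theorem volume_fundamentalDomain_latticeBasis_le :
    volume (ZSpan.fundamentalDomain (latticeBasis F)) ≤ ENNReal.ofReal √|(discr F : ℝ)| := by
  rw [volume_fundamentalDomain_latticeBasis]
  refine (mul_le_of_le_one_left zero_le (pow_le_one₀ zero_le (by simp))).trans_eq ?_
  rw [← ENNReal.ofReal_coe_nnreal, Real.coe_sqrt, coe_nnnorm, Int.norm_eq_abs]

open scoped Classical in
theorem pow_finrank_le_ncard_mul_sqrt_discr (F : Type*) [Field F] [NumberField F] {r : ℝ}
    (hr : 0 < r) :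
    r ^ finrank ℚ F ≤ {x : 𝓞 F | house (x : F) < 2 * r}.ncard * √|(discr F : ℝ)| := by
  have : VAddInvariantMeasure (mixedEmbedding.integerLattice F)
      (mixedEmbedding.mixedSpace F) volume :=
    inferInstanceAs (VAddInvariantMeasure (mixedEmbedding.integerLattice F).toAddSubgroup _ _)
  have hvol := measure_le_mul_of_encard_le (mixedEmbedding.fundamentalDomain_integerLattice F)
    measurableSet_ball _ (encard_integerLattice_vadd_mem_ball_le · r)
  rw [← ENNReal.ofReal_le_ofReal_iff (by positivity), ENNReal.ofReal_mul (by positivity),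
    ENNReal.ofReal_natCast]
  exact (ofReal_pow_finrank_le_volume_ball hr).trans
    (hvol.trans (mul_le_mul_right volume_fundamentalDomain_latticeBasis_le _))

end LatticeCounting

/-! ### Reduced pairs -/

section ReducedPair

open Module

variable {k K : Type*} [Field k] [Field K] [NumberField K] [Algebra k K]

theorem exists_notMem_forall_house_lt_mem [CharZero k] {V : Submodule k K} (hV : V ≠ ⊤) :
    ∃ α : 𝓞 K, (α : K) ∉ V ∧ ∀ x : 𝓞 K, house (x : K) < house (α : K) → (x : K) ∈ V := by
  suffices h : ∃ θ : 𝓞 K, (θ : K) ∉ V by simpa using exists_forall_house_lt_imp_not h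
  by_contra! hV'
  refine hV ((V.restrictScalars_eq_top_iff ℚ).1 (top_le_iff.1 ?_))
  rw [← (integralBasis K).span_eq, Submodule.span_le]
  rintro _ ⟨i, rfl⟩
  rw [integralBasis_apply]
  exact hV' _

variable (k) in
/-- `α` and `β` realise the second and third successive minima of the house on `𝓞 K` relative
to `k`, the first being realised by `1`. -/
structure IsReducedPair (α β : 𝓞 K) : Prop where
  left_notMem : (α : K) ∉ Submodule.span k {1}
  mem_of_lt_left (x : 𝓞 K) : house (x : K) < house (α : K) → (x : K) ∈ Submodule.span k {1}
  right_notMem : (β : K) ∉ Submodule.span k {1, (α : K)}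
  mem_of_lt_right (x : 𝓞 K) :
    house (x : K) < house (β : K) → (x : K) ∈ Submodule.span k {1, (α : K)}

theorem exists_isReducedPair [CharZero k] (h3 : 3 ≤ finrank k K) :
    ∃ α β : 𝓞 K, IsReducedPair k α β := by
  have hne {s : Set K} (hs : s.Finite) (hcard : s.ncard < 3) : Submodule.span k s ≠ ⊤ := by
    have := hs.fintype
    intro htop
    have hle := finrank_span_le_card (R := k) s
    rw [htop, finrank_top, ← Set.ncard_eq_toFinset_card'] at hle
    omega
  obtain ⟨α, hα, hαmin⟩ := exists_notMem_forall_house_lt_mem (k := k) (hne (s := {(1 : K)})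
    (Set.finite_singleton _) (by simp))
  obtain ⟨β, hβ, hβmin⟩ := exists_notMem_forall_house_lt_mem (k := k) (hne (s := {1, (α : K)})
    (Set.toFinite _) ((Set.ncard_insert_le _ _).trans_lt (by simp)))
  exact ⟨α, β, hα, hαmin, hβ, hβmin⟩

theorem finrank_span_le_ncard_mul [NumberField k] {s : Set K} (hs : s.Finite) :
    finrank ℚ ((Submodule.span k s).restrictScalars ℚ) ≤ s.ncard * finrank ℚ k := by
  have := hs.fintype
  have htower := finrank_mul_finrank ℚ k (Submodule.span k s)
  rw [Set.ncard_eq_toFinset_card', mul_comm]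
  exact htower.symm.trans_le (Nat.mul_le_mul_left _ (finrank_span_le_card s))

namespace IsReducedPair

variable {α β : 𝓞 K}

theorem linearIndependent (h : IsReducedPair k α β) :
    LinearIndependent k ![1, (α : K), (β : K)] := by
  have hsnoc : ![1, (α : K), (β : K)] = Fin.snoc ![1, (α : K)] (β : K) := by
    ext i
    fin_cases i <;> rfl
  rw [hsnoc, linearIndependent_finSnoc, LinearIndependent.pair_iff' one_ne_zero]
  refine ⟨fun a ha => h.left_notMem (Submodule.mem_span_singleton.2 ⟨a, ha⟩), ?_⟩
  have hrange : Set.range ![1, (α : K)] = {1, (α : K)} := by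
    rw [Matrix.range_cons, Matrix.range_cons, Matrix.range_empty, Set.union_empty, Set.insert_eq]
  exact hrange ▸ h.right_notMem

theorem one_le_house (h : IsReducedPair k α β) : 1 ≤ house (α : K) :=
  _root_.one_le_house fun h0 => h.left_notMem (by simp [h0])

theorem house_le (h : IsReducedPair k α β) : house (α : K) ≤ house (β : K) := by
  by_contra! hlt
  exact h.right_notMem (Submodule.span_mono (by simp) (h.mem_of_lt_left β hlt))

variable [NumberField k]

theorem card_le_of_house_sub_lt (h : IsReducedPair k α β) {t : Finset (𝓞 K)}
    (ht : ∀ x ∈ t, ∀ y ∈ t, house (x - y : K) < house (α : K)) :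
    (t.card : ℝ) ≤ (3 * house (α : K)) ^ finrank ℚ k := by
  have hα := h.one_le_house
  rcases t.eq_empty_or_nonempty with rfl | ⟨x₀, hx₀⟩
  · simp only [Finset.card_empty, Nat.cast_zero]
    positivity
  have hcard := card_le_mul_pow_finrank_of_house_le (δ := 1)
    ((Submodule.span k {(1 : K)}).restrictScalars ℚ) t (fun x => (x : K) - x₀) 1
    (house_nonneg (α : K)) one_pos
    (fun x hx => by simpa using h.mem_of_lt_left (x - x₀) (by simpa using ht x hx x₀ hx₀))
    (fun x hx => (ht x hx x₀ hx₀).le)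
    (fun u _ hu => Finset.card_le_one.2 fun x hx y hy => by
      by_contra hne
      have hsub := hu x hx y hy
      rw [sub_sub_sub_cancel_right, ← map_sub] at hsub
      exact (_root_.one_le_house (sub_ne_zero.2 hne)).not_gt hsub)
  have hdim := finrank_span_le_ncard_mul (k := k) (Set.finite_singleton (1 : K))
  rw [Set.ncard_singleton, one_mul] at hdim
  rw [Nat.cast_one, one_mul, div_one] at hcard
  calc (t.card : ℝ) ≤ (1 + 2 * house (α : K)) ^ finrank ℚ k :=
        hcard.trans (pow_le_pow_right₀ (by linarith) hdim)
    _ ≤ (3 * house (α : K)) ^ finrank ℚ k :=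
        pow_le_pow_left₀ (by positivity) (by linarith) _

theorem ncard_house_lt_le (h : IsReducedPair k α β) :
    ({x : 𝓞 K | house (x : K) < house (β : K)}.ncard : ℝ) ≤
      (27 * (house (β : K) ^ 2 / house (α : K))) ^ finrank ℚ k := by
  have hα : 0 < house (α : K) := one_pos.trans_le h.one_le_house
  have hβ : 1 ≤ house (β : K) / house (α : K) := (one_le_div hα).2 h.house_le
  have hdim : finrank ℚ ((Submodule.span k {1, (α : K)}).restrictScalars ℚ) ≤
      2 * finrank ℚ k :=
    (finrank_span_le_ncard_mul (Set.toFinite _)).trans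
      (Nat.mul_le_mul_right _ ((Set.ncard_insert_le _ _).trans (by simp)))
  rw [Set.ncard_eq_toFinset_card _ (finite_setOf_house_lt K _)]
  have hcard := card_le_mul_pow_finrank_of_house_le
    ((Submodule.span k {1, (α : K)}).restrictScalars ℚ)
    (finite_setOf_house_lt K (house (β : K))).toFinset (fun x => (x : K))
    ⌊(3 * house (α : K)) ^ finrank ℚ k⌋₊ (house_nonneg (β : K)) hα
    (fun x hx => h.mem_of_lt_right x (by simpa using hx))
    (fun x hx => le_of_lt (by simpa using hx))
    (fun t _ ht => Nat.le_floor (h.card_le_of_house_sub_lt ht))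
  have hbase : 1 + 2 * house (β : K) / house (α : K) ≤ 3 * (house (β : K) / house (α : K)) := by
    rw [mul_div_assoc]
    linarith
  have hone : 1 ≤ 1 + 2 * house (β : K) / house (α : K) := by
    rw [mul_div_assoc]
    linarith
  calc _ ≤ _ := hcard
    _ ≤ (3 * house (α : K)) ^ finrank ℚ k *
          (3 * (house (β : K) / house (α : K))) ^ (2 * finrank ℚ k) :=
        mul_le_mul (Nat.floor_le (by positivity))
          ((pow_le_pow_right₀ hone hdim).trans (pow_le_pow_left₀ (by linarith) hbase _))
          (by positivity) (by positivity)
    _ = (27 * (house (β : K) ^ 2 / house (α : K))) ^ finrank ℚ k := by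
        rw [pow_mul, ← mul_pow]
        congr 1
        field_simp
        ring

theorem house_mul_house_pow_le (h : IsReducedPair k α β) (h3 : finrank k K = 3) :
    (house (α : K) * house (β : K)) ^ finrank ℚ k ≤
      216 ^ finrank ℚ k * √|(discr K : ℝ)| := by
  have hα : 0 < house (α : K) := one_pos.trans_le h.one_le_house
  have hβ : 0 < house (β : K) := hα.trans_le h.house_le
  have hvol := pow_finrank_le_ncard_mul_sqrt_discr K (half_pos hβ)
  rw [mul_div_cancel₀ _ two_ne_zero, ← finrank_mul_finrank ℚ k K, h3, mul_comm (finrank ℚ k),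
    pow_mul] at hvol
  have hcount := hvol.trans
    (mul_le_mul_of_nonneg_right h.ncard_house_lt_le (Real.sqrt_nonneg |(discr K : ℝ)|))
  have hsplit : house (α : K) * house (β : K) =
      216 * ((house (β : K) / 2) ^ 3 / (27 * (house (β : K) ^ 2 / house (α : K)))) := by
    field_simp
    norm_num
  rw [hsplit, mul_pow, div_pow]
  gcongr
  rwa [div_le_iff₀' (by positivity)]

end IsReducedPair

end ReducedPair

/-! ### Discriminants and coordinates -/

section Discriminant

open Module

theorem isIntegral_update {F ι : Type*} [Field F] [DecidableEq ι] {c : ι → F}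
    (hc : ∀ i, IsIntegral ℤ (c i)) {x : F} (hx : IsIntegral ℤ x) (i j : ι) :
    IsIntegral ℤ (Function.update c i x j) := by
  rcases eq_or_ne j i with rfl | hji
  · rwa [Function.update_self]
  · rw [Function.update_of_ne hji]
    exact hc j

variable {F : Type*} [Field F] [NumberField F] {ι : Type*} [Fintype ι] [DecidableEq ι]

theorem exists_discr_eq_sq_mul_discr (hι : Fintype.card ι = finrank ℚ F) {c : ι → F}
    (hc : ∀ i, IsIntegral ℤ (c i)) :
    ∃ m : ℤ, Algebra.discr ℚ c = (m : ℚ) ^ 2 * (discr F : ℚ) := by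
  let e : Free.ChooseBasisIndex ℤ (𝓞 F) ≃ ι :=
    Fintype.equivOfCardEq ((finrank_eq_card_basis (integralBasis F)).symm.trans hι.symm)
  let b := (integralBasis F).reindex e
  let P : Matrix ι ι ℤ :=
    .of fun i j => (RingOfIntegers.basis F).repr ⟨c i, hc i⟩ (e.symm j)
  have hP : c = Matrix.mulVec ((P.map (Int.castRingHom ℚ)).map (algebraMap ℚ F)) b := by
    ext i
    have hrepr := congrArg (algebraMap (𝓞 F) F) ((RingOfIntegers.basis F).sum_repr ⟨c i, hc i⟩)
    rw [map_sum, ← e.symm.sum_comp] at hrepr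
    refine hrepr.symm.trans (Finset.sum_congr rfl fun j _ => ?_)
    simp [P, b, integralBasis_apply]
  refine ⟨P.det, ?_⟩
  rw [hP, Algebra.discr_of_matrix_mulVec, coe_discr, Basis.coe_reindex, Algebra.discr_reindex]
  exact congrArg (· ^ 2 * _) (RingHom.map_det (Int.castRingHom ℚ) P).symm

theorem norm_det_le_factorial_mul_prod {𝕜 : Type*} [NormedField 𝕜] (M : Matrix ι ι 𝕜) {h : ι → ℝ}
    (hM : ∀ i j, ‖M i j‖ ≤ h i) : ‖M.det‖ ≤ (Fintype.card ι).factorial * ∏ i, h i := by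
  have hterm (σ : Equiv.Perm ι) : ‖Equiv.Perm.sign σ • ∏ i, M (σ i) i‖ ≤ ∏ i, h i := by
    have hsign : ‖Equiv.Perm.sign σ • ∏ i, M (σ i) i‖ = ‖∏ i, M (σ i) i‖ := by
      rcases Int.units_eq_one_or (Equiv.Perm.sign σ) with hσ | hσ <;> simp [hσ]
    rw [hsign, norm_prod, ← Equiv.prod_comp σ h]
    exact Finset.prod_le_prod (fun _ _ => norm_nonneg _) fun i _ => hM _ _
  rw [Matrix.det_apply]
  calc ‖∑ σ : Equiv.Perm ι, Equiv.Perm.sign σ • ∏ i, M (σ i) i‖ ≤ ∑ _σ : Equiv.Perm ι, ∏ i, h i :=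
        norm_sum_le_of_le _ fun σ _ => hterm σ
    _ = (Fintype.card ι).factorial * ∏ i, h i := by
        rw [Finset.sum_const, Finset.card_univ, Fintype.card_perm, nsmul_eq_mul]

theorem sqrt_abs_discr_le_of_house_le (hι : Fintype.card ι = finrank ℚ F) {c : ι → F} {h : ι → ℝ}
    (hc : ∀ i, house (c i) ≤ h i) :
    √|((Algebra.discr ℚ c : ℚ) : ℝ)| ≤ (Fintype.card ι).factorial * ∏ i, h i := by
  let e : ι ≃ (F →ₐ[ℚ] ℂ) := Fintype.equivOfCardEq (by rw [hι, AlgHom.card])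
  have hdiscr := Algebra.discr_eq_det_embeddingsMatrixReindex_pow_two ℚ ℂ c e
  have hnorm : |((Algebra.discr ℚ c : ℚ) : ℝ)| =
      ‖(Algebra.embeddingsMatrixReindex ℚ ℂ c e).det‖ ^ 2 := by
    rw [← norm_pow, ← hdiscr, eq_ratCast, Complex.norm_ratCast]
  rw [hnorm, Real.sqrt_sq (norm_nonneg _)]
  exact norm_det_le_factorial_mul_prod _ fun i j =>
    (norm_embedding_le_house (c i) ((e j : F →ₐ[ℚ] ℂ) : F →+* ℂ)).trans (hc i)

theorem sqrt_abs_discr_eq {c : ι → F} {m : ℤ}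
    (hm : Algebra.discr ℚ c = (m : ℚ) ^ 2 * (discr F : ℚ)) :
    √|((Algebra.discr ℚ c : ℚ) : ℝ)| = |(m : ℝ)| * √|(discr F : ℝ)| := by
  rw [hm]
  push_cast
  rw [abs_mul, abs_pow, Real.sqrt_mul (by positivity), Real.sqrt_sq (abs_nonneg _)]

theorem sqrt_abs_discr_pos (F : Type*) [Field F] [NumberField F] : 0 < √|(discr F : ℝ)| :=
  Real.sqrt_pos.2 (abs_pos.2 (by exact_mod_cast discr_ne_zero F))

theorem discr_update_basis (b : Basis ι ℚ F) (i : ι) (x : F) :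
    Algebra.discr ℚ (Function.update b i x) = b.repr x i ^ 2 * Algebra.discr ℚ b := by
  let P : Matrix ι ι ℚ := (1 : Matrix ι ι ℚ).updateCol i (b.repr x)
  have hP : Function.update b i x = Matrix.vecMul b (P.map (algebraMap ℚ F)) := by
    ext j
    by_cases hj : j = i
    · subst hj
      rw [Function.update_self]
      refine (b.sum_repr x).symm.trans (Finset.sum_congr rfl fun l _ => ?_)
      simp [P, Algebra.smul_def, mul_comm]
    · rw [Function.update_of_ne hj]
      simp [P, Matrix.vecMul, dotProduct, Matrix.updateCol_ne hj, Matrix.one_apply, apply_ite]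
  have hdet : P.det = b.repr x i := by
    rw [← Matrix.cramer_apply, Matrix.cramer_one, Module.End.one_apply]
  rw [hP, Algebra.discr_of_matrix_vecMul, hdet]

theorem exists_int_mul_repr_eq (b : Basis ι ℚ F) (hb : ∀ i, IsIntegral ℤ (b i)) {m : ℤ}
    (hm : Algebra.discr ℚ b = (m : ℚ) ^ 2 * (discr F : ℚ)) {x : F} (hx : IsIntegral ℤ x) (i : ι) :
    ∃ r : ℤ, (m : ℚ) * b.repr x i = r := by
  obtain ⟨m', hm'⟩ := exists_discr_eq_sq_mul_discr (finrank_eq_card_basis b).symm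
    (isIntegral_update hb hx i)
  have hdiscr : (discr F : ℚ) ≠ 0 := by exact_mod_cast discr_ne_zero F
  have hsq : ((m : ℚ) * b.repr x i) ^ 2 = (m' : ℚ) ^ 2 := by
    refine mul_right_cancel₀ hdiscr ?_
    rw [← hm', discr_update_basis, hm]
    ring
  rcases sq_eq_sq_iff_eq_or_eq_neg.1 hsq with h | h
  · exact ⟨m', h⟩
  · exact ⟨-m', by rw [h, Int.cast_neg]⟩

theorem exists_discr_basis_eq_sq_mul (b : Basis ι ℚ F) (hb : ∀ i, IsIntegral ℤ (b i)) :
    ∃ m : ℤ, m ≠ 0 ∧ Algebra.discr ℚ b = (m : ℚ) ^ 2 * (discr F : ℚ) := by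
  obtain ⟨m, hm⟩ := exists_discr_eq_sq_mul_discr (finrank_eq_card_basis b).symm hb
  refine ⟨m, ?_, hm⟩
  rintro rfl
  exact Algebra.discr_not_zero_of_basis ℚ b (by simp [hm])

end Discriminant

section IntegralCoordinates

open Module

variable {F : Type*} [Field F] [NumberField F] {ι : Type*} [Fintype ι] {h : ι → ℝ} {D : ℝ}

theorem exists_factorial_mul_repr_eq (b : Basis ι ℚ F) (hb : ∀ i, IsIntegral ℤ (b i))
    (hbh : ∀ i, house (b i) ≤ h i)
    (hD : (Fintype.card ι).factorial * ∏ i, h i ≤ D * √|(discr F : ℝ)|)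
    {x : F} (hx : IsIntegral ℤ x) (i : ι) :
    ∃ r : ℤ, (⌊D⌋₊.factorial : ℚ) * b.repr x i = r := by
  classical
  obtain ⟨m, hm0, hm⟩ := exists_discr_basis_eq_sq_mul b hb
  have hmD : |(m : ℝ)| ≤ D := by
    refine le_of_mul_le_mul_right ?_ (sqrt_abs_discr_pos F)
    rw [← sqrt_abs_discr_eq hm]
    exact (sqrt_abs_discr_le_of_house_le (finrank_eq_card_basis b).symm hbh).trans hD
  have hdvd : m ∣ (⌊D⌋₊.factorial : ℤ) := by
    rw [← Int.natAbs_dvd, Int.natCast_dvd_natCast]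
    refine Nat.dvd_factorial (Int.natAbs_pos.2 hm0) (Nat.le_floor ?_)
    rwa [Nat.cast_natAbs, Int.cast_abs]
  obtain ⟨t, ht⟩ := hdvd
  obtain ⟨r, hr⟩ := exists_int_mul_repr_eq b hb hm hx i
  refine ⟨r * t, ?_⟩
  have ht' : (⌊D⌋₊.factorial : ℚ) = m * t := by exact_mod_cast ht
  rw [ht', Int.cast_mul, ← hr]
  ring

theorem abs_repr_mul_le (b : Basis ι ℚ F) (hb : ∀ i, IsIntegral ℤ (b i))
    (hbh : ∀ i, house (b i) ≤ h i)
    (hD : (Fintype.card ι).factorial * ∏ i, h i ≤ D * √|(discr F : ℝ)|) (x : F) (i : ι) :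
    |(b.repr x i : ℝ)| * h i ≤ D * house x := by
  classical
  obtain ⟨m, hm0, hm⟩ := exists_discr_basis_eq_sq_mul b hb
  have hi : 0 ≤ h i := (house_nonneg _).trans (hbh i)
  have hm1 : 1 ≤ |(m : ℝ)| := by exact_mod_cast Int.one_le_abs hm0
  have hupdate : |(b.repr x i : ℝ)| * (|(m : ℝ)| * √|(discr F : ℝ)|) ≤
      (Fintype.card ι).factorial * (house x * ∏ j ∈ Finset.univ \ {i}, h j) := by
    rw [← sqrt_abs_discr_eq hm, ← Finset.prod_update_of_mem (Finset.mem_univ i)]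
    refine le_trans (le_of_eq ?_) (sqrt_abs_discr_le_of_house_le (c := Function.update b i x)
      (finrank_eq_card_basis b).symm fun j => ?_)
    · rw [discr_update_basis, Rat.cast_mul, Rat.cast_pow, abs_mul, abs_pow,
        Real.sqrt_mul (by positivity), Real.sqrt_sq (abs_nonneg _)]
    · rcases eq_or_ne j i with rfl | hji
      · simp
      · simpa [Function.update_of_ne hji] using hbh j
  refine le_of_mul_le_mul_right ?_ (sqrt_abs_discr_pos F)
  calc |(b.repr x i : ℝ)| * h i * √|(discr F : ℝ)|
      = h i * (|(b.repr x i : ℝ)| * (1 * √|(discr F : ℝ)|)) := by ring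
    _ ≤ h i * (|(b.repr x i : ℝ)| * (|(m : ℝ)| * √|(discr F : ℝ)|)) := by gcongr
    _ ≤ h i * ((Fintype.card ι).factorial * (house x * ∏ j ∈ Finset.univ \ {i}, h j)) :=
        mul_le_mul_of_nonneg_left hupdate hi
    _ = house x * ((Fintype.card ι).factorial * ∏ j, h j) := by
        rw [← Finset.mul_prod_erase _ _ (Finset.mem_univ i), Finset.sdiff_singleton_eq_erase]
        ring
    _ ≤ house x * (D * √|(discr F : ℝ)|) := mul_le_mul_of_nonneg_left hD (house_nonneg x)
    _ = D * house x * √|(discr F : ℝ)| := by ring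

end IntegralCoordinates

section RelativeCoordinates

open Module

variable {k K : Type*} [Field k] [NumberField k] [Field K] [NumberField K] [Algebra k K]
  {τ κ : Type*} {H D : ℝ}

theorem isIntegral_smulTower {ω : Basis τ ℚ k} {c : Basis κ k K} (hω : ∀ i, IsIntegral ℤ (ω i))
    (hc : ∀ j, IsIntegral ℤ (c j)) (ij : τ × κ) : IsIntegral ℤ (ω.smulTower c ij) := by
  rw [Basis.smulTower_apply, Algebra.smul_def]
  exact ((hω ij.1).map (algebraMap k K).toIntAlgHom).mul (hc ij.2)

theorem house_smulTower_le {ω : Basis τ ℚ k} {c : Basis κ k K} (hω : ∀ i, house (ω i) ≤ H)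
    (ij : τ × κ) : house (ω.smulTower c ij) ≤ H * house (c ij.2) := by
  rw [Basis.smulTower_apply, Algebra.smul_def]
  exact (house_mul_le _ _).trans (mul_le_mul_of_nonneg_right
    ((house_algebraMap_le _).trans (hω _)) (house_nonneg _))

variable [Fintype τ]

theorem house_sum_intCast_mul_le {ω : τ → k} (hω : ∀ i, house (ω i) ≤ H) (r : τ → ℤ) :
    house (∑ i, (r i : k) * ω i) ≤ ∑ i, |(r i : ℝ)| * H := by
  refine (house_sum_le_sum_house _ _).trans
    (Finset.sum_le_sum fun i _ => (house_mul_le _ _).trans ?_)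
  rw [house_intCast, Int.cast_abs]
  exact mul_le_mul_of_nonneg_left (hω i) (abs_nonneg _)

theorem natCast_mul_repr_eq_sum {ω : Basis τ ℚ k} {c : Basis κ k K} {x : K} {N : ℕ}
    {r : τ × κ → ℤ} (hr : ∀ ij, (N : ℚ) * (ω.smulTower c).repr x ij = r ij) (j : κ) :
    (N : k) * c.repr x j = ∑ i, (r (i, j) : k) * ω i := by
  conv_lhs => rw [← ω.sum_repr (c.repr x j), Finset.mul_sum]
  refine Finset.sum_congr rfl fun i _ => ?_
  rw [← Rat.cast_intCast, ← hr, Basis.smulTower_repr_mk, Algebra.smul_def, eq_ratCast,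
    Rat.cast_mul, Rat.cast_natCast, mul_assoc]

variable [Fintype κ]

theorem exists_integral_coordinates (ω : Basis τ ℚ k) (hω : ∀ i, IsIntegral ℤ (ω i))
    (hωH : ∀ i, house (ω i) ≤ H) (c : Basis κ k K) (hc : ∀ j, IsIntegral ℤ (c j))
    (hD : (Fintype.card τ * Fintype.card κ).factorial * (H ^ (Fintype.card τ * Fintype.card κ) *
      (∏ j, house (c j)) ^ Fintype.card τ) ≤ D * √|(discr K : ℝ)|) (x : 𝓞 K) :
    ∃ y : κ → 𝓞 k, (⌊D⌋₊.factorial : K) * x = ∑ j, algebraMap k K (y j) * c j ∧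
      ∀ j, house (y j : k) * house (c j) ≤
        ⌊D⌋₊.factorial * (Fintype.card τ * D) * house (x : K) := by
  have hprod : ∏ ij : τ × κ, H * house (c ij.2) = H ^ (Fintype.card τ * Fintype.card κ) *
      (∏ j, house (c j)) ^ Fintype.card τ := by
    rw [Finset.prod_mul_distrib, Finset.prod_const, Finset.card_univ, Fintype.card_prod,
      Fintype.prod_prod_type]
    simp only [Finset.prod_const, Finset.card_univ]
  rw [← hprod, ← Fintype.card_prod] at hD
  let B : Basis (τ × κ) ℚ K := ω.smulTower c
  have hB : ∀ ij, IsIntegral ℤ (B ij) := isIntegral_smulTower hω hc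
  choose r hr using exists_factorial_mul_repr_eq B hB (house_smulTower_le hωH) hD x.2
  have hsize := abs_repr_mul_le B hB (house_smulTower_le hωH) hD (x : K)
  have habs (ij : τ × κ) : |(r ij : ℝ)| = ⌊D⌋₊.factorial * |(B.repr x ij : ℝ)| := by
    rw [← Nat.abs_cast, ← abs_mul]
    exact_mod_cast congrArg (fun q : ℚ => |(q : ℝ)|) (hr ij).symm
  have hy (j : κ) : (⌊D⌋₊.factorial : k) * c.repr x j = ∑ i, (r (i, j) : k) * ω i :=
    natCast_mul_repr_eq_sum hr j
  have hint (j : κ) : ∃ y : 𝓞 k, (y : k) = ⌊D⌋₊.factorial * c.repr x j := by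
    have hsum : IsIntegral ℤ (⌊D⌋₊.factorial * c.repr x j : k) := by
      rw [hy]
      exact IsIntegral.sum _ fun i _ => (isIntegral_algebraMap (x := r (i, j))).mul (hω i)
    exact ⟨⟨_, hsum⟩, rfl⟩
  choose y hrepr using hint
  refine ⟨y, ?_, fun j => ?_⟩
  · conv_lhs => rw [← c.sum_repr x, Finset.mul_sum]
    refine Finset.sum_congr rfl fun j _ => ?_
    rw [hrepr, map_mul, map_natCast, Algebra.smul_def, mul_assoc]
  · rw [hrepr, hy]
    calc house (∑ i, (r (i, j) : k) * ω i) * house (c j)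
        ≤ (∑ i, |(r (i, j) : ℝ)| * H) * house (c j) :=
          mul_le_mul_of_nonneg_right (house_sum_intCast_mul_le hωH _) (house_nonneg _)
      _ = ∑ i, ⌊D⌋₊.factorial *
            (|(B.repr x (i, j) : ℝ)| * (H * house (c j))) := by
          rw [Finset.sum_mul]
          refine Finset.sum_congr rfl fun i _ => ?_
          rw [habs]
          ring
      _ ≤ ∑ _i : τ, ⌊D⌋₊.factorial * (D * house (x : K)) :=
          Finset.sum_le_sum fun i _ =>
            mul_le_mul_of_nonneg_left (hsize (i, j)) (Nat.cast_nonneg _)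
      _ = ⌊D⌋₊.factorial * (Fintype.card τ * D) * house (x : K) := by
          rw [Finset.sum_const, Finset.card_univ, nsmul_eq_mul]
          ring

end RelativeCoordinates

/-! ### Cubic generators and the Delone–Faddeev correspondence -/

section CubicGenerator

open Module Polynomial

/-- `ρ` generates an extension of `k` as a root of the cubic polynomial `P`; the condition
`ρ ∉ k` suffices for this in an extension of degree `3`. -/
structure IsCubicGenerator {k K : Type*} [Field k] [Field K] [Algebra k K] (P : Cubic k) (ρ : K) :
    Prop where
  leadingCoeff_ne_zero : P.a ≠ 0
  notMem_range : ρ ∉ Set.range (algebraMap k K)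
  aeval_eq_zero : aeval ρ P.toPoly = 0

theorem natDegree_minpoly_eq_finrank {k K : Type*} [Field k] [Field K] [Algebra k K]
    (hprime : (finrank k K).Prime) {x : K} (hx : x ∉ Set.range (algebraMap k K)) :
    (minpoly k x).natDegree = finrank k K := by
  have : FiniteDimensional k K := Module.finite_of_finrank_pos hprime.pos
  refine ((Nat.dvd_prime hprime).1 (minpoly.degree_dvd
    (Algebra.IsIntegral.isIntegral (R := k) x))).resolve_left fun h => hx ?_
  exact minpoly.natDegree_eq_one_iff.1 h

theorem adjoin_eq_top_of_notMem_range {k K : Type*} [Field k] [Field K] [Algebra k K]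
    (hprime : (finrank k K).Prime) {x : K} (hx : x ∉ Set.range (algebraMap k K)) :
    Algebra.adjoin k {x} = ⊤ := by
  have : FiniteDimensional k K := Module.finite_of_finrank_pos hprime.pos
  refine Algebra.adjoin_eq_top_of_primitive_element (Algebra.IsAlgebraic.isAlgebraic x) ?_
  rw [Field.primitive_element_iff_minpoly_natDegree_eq]
  exact natDegree_minpoly_eq_finrank hprime hx

theorem quadratic_ne_zero_of_notMem_range {k K : Type*} [Field k] [Field K] [Algebra k K]
    (h3 : finrank k K = 3) {x : K} (hx : x ∉ Set.range (algebraMap k K)) {r : k} (hr : r ≠ 0)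
    (s t : k) : algebraMap k K r * x ^ 2 + algebraMap k K s * x + algebraMap k K t ≠ 0 := by
  intro hroot
  have hne : C r * X ^ 2 + C s * X + C t ≠ 0 := fun h => by
    simpa [h] using natDegree_quadratic (b := s) (c := t) hr
  have hle := natDegree_le_of_dvd
    (minpoly.dvd k x (p := C r * X ^ 2 + C s * X + C t) (by simpa using hroot)) hne
  rw [natDegree_minpoly_eq_finrank (h3 ▸ Nat.prime_three) hx, h3, natDegree_quadratic hr] at hle
  omega

section Field

variable {k K L : Type*} [Field k] [Field K] [Field L] [Algebra k K] [Algebra k L] {P : Cubic k}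
  {ρ : K} {σ : L}

theorem IsCubicGenerator.minpoly_eq (h3 : finrank k K = 3) (h : IsCubicGenerator P ρ) :
    minpoly k ρ = C P.a⁻¹ * P.toPoly := by
  have : FiniteDimensional k K := Module.finite_of_finrank_pos (by omega)
  have hmonic : (C P.a⁻¹ * P.toPoly).Monic := by
    rw [Monic, leadingCoeff_mul, leadingCoeff_C, Cubic.leadingCoeff_of_a_ne_zero
      h.leadingCoeff_ne_zero, inv_mul_cancel₀ h.leadingCoeff_ne_zero]
  refine (eq_of_monic_of_dvd_of_natDegree_le (minpoly.monic (Algebra.IsIntegral.isIntegral ρ))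
    hmonic (minpoly.dvd k ρ ?_) ?_).symm
  · rw [map_mul, h.aeval_eq_zero, mul_zero]
  · rw [natDegree_minpoly_eq_finrank (h3 ▸ Nat.prime_three) h.notMem_range, h3,
      natDegree_C_mul (inv_ne_zero h.leadingCoeff_ne_zero),
      Cubic.natDegree_of_a_ne_zero h.leadingCoeff_ne_zero]

theorem IsCubicGenerator.nonempty_algEquiv (hK : finrank k K = 3) (hL : finrank k L = 3)
    (hρ : IsCubicGenerator P ρ) (hσ : IsCubicGenerator P σ) : Nonempty (K ≃ₐ[k] L) := by
  have : FiniteDimensional k K := Module.finite_of_finrank_pos (by omega)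
  have : FiniteDimensional k L := Module.finite_of_finrank_pos (by omega)
  let pbρ := PowerBasis.ofAdjoinEqTop (Algebra.IsIntegral.isIntegral ρ)
    (adjoin_eq_top_of_notMem_range (hK ▸ Nat.prime_three) hρ.notMem_range)
  let pbσ := PowerBasis.ofAdjoinEqTop (Algebra.IsIntegral.isIntegral σ)
    (adjoin_eq_top_of_notMem_range (hL ▸ Nat.prime_three) hσ.notMem_range)
  refine ⟨pbρ.equivOfMinpoly pbσ ?_⟩
  simp only [pbρ, pbσ, PowerBasis.ofAdjoinEqTop_gen, hρ.minpoly_eq hK, hσ.minpoly_eq hL]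

end Field

section MonicAssociate

variable {R S : Type*} [CommRing R] [CommRing S] [Algebra R S]

/-- The monic cubic polynomial satisfied by `a * ρ` when `ρ` is a root of the cubic polynomial `P`
with leading coefficient `a`. -/
def monicAssociate (P : Cubic R) : Cubic R :=
  ⟨1, P.b, P.a * P.c, P.a ^ 2 * P.d⟩

theorem discr_monicAssociate (P : Cubic R) :
    (monicAssociate P).discr = P.a ^ 2 * P.discr := by
  simp only [monicAssociate, Cubic.discr]
  ring

theorem aeval_monicAssociate (P : Cubic R) (ρ : S) :
    aeval (algebraMap R S P.a * ρ) (monicAssociate P).toPoly =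
      algebraMap R S P.a ^ 2 * aeval ρ P.toPoly := by
  simp only [monicAssociate, Cubic.toPoly, map_add, map_mul, aeval_C, map_pow, aeval_X, map_one]
  ring

theorem discr_mem_of_aeval_derivative_mem {P : Cubic R} {x : S} (hroot : aeval x P.toPoly = 0)
    {I : Ideal S} (hI : aeval x (derivative P.toPoly) ∈ I) : algebraMap R S P.discr ∈ I := by
  have hder : aeval x (derivative P.toPoly) = 3 * algebraMap R S P.a * x ^ 2 +
      2 * algebraMap R S P.b * x + algebraMap R S P.c := by
    simp only [Cubic.toPoly, derivative_mul, derivative_C, derivative_X_pow,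
      derivative_X, map_add, map_mul, aeval_C, aeval_X, map_pow, map_zero, map_one, map_natCast]
    push_cast
    ring
  have hdiscr : algebraMap R S P.discr = aeval x (derivative P.toPoly) *
      (aeval x (derivative P.toPoly) * (algebraMap R S P.b ^ 2 -
        4 * algebraMap R S P.a * algebraMap R S P.c -
        2 * algebraMap R S P.a * algebraMap R S P.b * x -
        3 * algebraMap R S P.a ^ 2 * x ^ 2)) := by
    rw [hder]
    simp only [Cubic.toPoly, Cubic.discr, map_add, map_sub, map_mul, map_pow, map_ofNat, aeval_C,
      aeval_X] at hroot ⊢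
    generalize algebraMap R S P.a = a, algebraMap R S P.b = b, algebraMap R S P.c = c,
      algebraMap R S P.d = d at hroot ⊢
    linear_combination (27 * a ^ 3 * x ^ 3 + 27 * a ^ 2 * b * x ^ 2 + 27 * a ^ 2 * c * x -
      4 * b ^ 3 + 18 * a * b * c - 27 * a ^ 2 * d) * hroot
  rw [hdiscr]
  exact I.mul_mem_right _ hI

end MonicAssociate

theorem map_monicAssociate {R S : Type*} [CommRing R] [CommRing S] (P : Cubic R)
    (φ : R →+* S) : (monicAssociate P).map φ = monicAssociate (P.map φ) := by
  simp only [monicAssociate, Cubic.map, map_mul, map_pow, map_one]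

end CubicGenerator

section DeloneFaddeev

open Module Polynomial

/- The multiplication table of a cubic ring in a basis `1, A, B` normalised by `A * B ∈ k`:
associativity forces its shape to be that of the binary cubic form `(a, b, c, d)`. -/
theorem cubic_relation_of_mul_eq_algebraMap {k K : Type*} [Field k] [Field K] [Algebra k K]
    {A B : K} (hli : LinearIndependent k ![1, A, B]) {a b c d u u' e : k}
    (hAB : A * B = algebraMap k K e)
    (hA : A ^ 2 = algebraMap k K u - algebraMap k K b * A - algebraMap k K a * B)
    (hB : B ^ 2 = algebraMap k K u' - algebraMap k K d * A - algebraMap k K c * B) :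
    A ^ 3 + algebraMap k K b * A ^ 2 + algebraMap k K (a * c) * A + algebraMap k K (a ^ 2 * d) =
      0 := by
  have hassoc := Fintype.linearIndependent_iff.1 hli
    ![-(b * e + a * u'), a * d - e, u + a * c] (by
      simp only [Fin.sum_univ_three, Matrix.cons_val_zero, Matrix.cons_val_one, Matrix.cons_val,
        Algebra.smul_def, mul_one, map_sub, map_add, map_mul, map_neg]
      linear_combination (algebraMap k K b + A) * hAB - B * hA + algebraMap k K a * hB)
  have he : e = a * d := by
    have := hassoc 1
    simp only [Matrix.cons_val_one, Matrix.cons_val_zero] at this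
    linear_combination -this
  have hu : u = -(a * c) := by
    have := hassoc 2
    simp only [Matrix.cons_val] at this
    linear_combination this
  rw [he] at hAB
  rw [hu] at hA
  simp only [map_neg, map_mul, map_pow] at hAB hA ⊢
  linear_combination A * hA - algebraMap k K a * hAB

theorem linearIndependent_mul_sub {k K : Type*} [Field k] [Field K] [Algebra k K] {α β : K}
    (hli : LinearIndependent k ![1, α, β]) {N : k} (hN : N ≠ 0) (s t : k) :
    LinearIndependent k ![1, algebraMap k K N * α - algebraMap k K s,
      algebraMap k K N * β - algebraMap k K t] := by
  refine Fintype.linearIndependent_iff.2 fun g hg => ?_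
  have h := Fintype.linearIndependent_iff.1 hli
    ![g 0 - g 1 * s - g 2 * t, g 1 * N, g 2 * N] (by
      simp only [Fin.sum_univ_three, Matrix.cons_val_zero, Matrix.cons_val_one, Matrix.cons_val,
        Algebra.smul_def, mul_one, map_sub, map_mul] at hg ⊢
      linear_combination hg)
  have h1 : g 1 = 0 := (mul_eq_zero.1 (h 1)).resolve_right hN
  have h2 : g 2 = 0 := (mul_eq_zero.1 (h 2)).resolve_right hN
  have h0 : g 0 = 0 := by simpa [h1, h2] using h 0
  exact fun i => by fin_cases i <;> assumption

theorem notMem_range_of_linearIndependent {k K : Type*} [Field k] [Field K] [Algebra k K]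
    {α β : K} (hli : LinearIndependent k ![1, α, β]) : α ∉ Set.range (algebraMap k K) := by
  rintro ⟨t, rfl⟩
  have := Fintype.linearIndependent_iff.1 hli ![t, -1, 0]
    (by simp [Fin.sum_univ_three, Algebra.smul_def]) 1
  simp at this

theorem isCubicGenerator_of_mul_eq {k K : Type*} [Field k] [Field K] [Algebra k K]
    (h3 : finrank k K = 3) {α β : K} (hli : LinearIndependent k ![1, α, β]) {N : k} (hN : N ≠ 0)
    {u₁ v₁ w₁ u₂ v₂ w₂ u₃ v₃ w₃ : k}
    (hαα : algebraMap k K N * (α * α) =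
      algebraMap k K u₁ + algebraMap k K v₁ * α + algebraMap k K w₁ * β)
    (hαβ : algebraMap k K N * (α * β) =
      algebraMap k K u₂ + algebraMap k K v₂ * α + algebraMap k K w₂ * β)
    (hββ : algebraMap k K N * (β * β) =
      algebraMap k K u₃ + algebraMap k K v₃ * α + algebraMap k K w₃ * β) :
    ∃ ρ : K, IsCubicGenerator ⟨-w₁, 2 * w₂ - v₁, 2 * v₂ - w₃, -v₃⟩ ρ := by
  set A := algebraMap k K N * α - algebraMap k K w₂
  set B := algebraMap k K N * β - algebraMap k K v₂
  have hliAB : LinearIndependent k ![1, A, B] := linearIndependent_mul_sub hli hN w₂ v₂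
  have hw₁ : w₁ ≠ 0 := by
    rintro rfl
    refine quadratic_ne_zero_of_notMem_range h3 (notMem_range_of_linearIndependent hli) hN
      (-v₁) (-u₁) ?_
    simp only [map_neg, map_zero] at hαα ⊢
    linear_combination hαα
  have hw₁K : algebraMap k K (-w₁) ≠ 0 := (_root_.map_ne_zero _).2 (neg_ne_zero.2 hw₁)
  have hcubic := cubic_relation_of_mul_eq_algebraMap hliAB (a := -w₁) (b := 2 * w₂ - v₁)
    (c := 2 * v₂ - w₃) (d := -v₃) (e := N * u₂ + v₂ * w₂)
    (u := N * u₁ + v₁ * w₂ + w₁ * v₂ - w₂ ^ 2) (u' := N * u₃ + v₃ * w₂ + w₃ * v₂ - v₂ ^ 2)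
    (by simp only [map_add, map_mul]; linear_combination algebraMap k K N * hαβ)
    (by
      simp only [map_add, map_mul, map_sub, map_neg, map_pow, map_ofNat]
      linear_combination algebraMap k K N * hαα)
    (by
      simp only [map_add, map_mul, map_sub, map_neg, map_pow, map_ofNat]
      linear_combination algebraMap k K N * hββ)
  refine ⟨A / algebraMap k K (-w₁), neg_ne_zero.2 hw₁, ?_, ?_⟩
  · rintro ⟨t, ht⟩
    exact notMem_range_of_linearIndependent hliAB
      ⟨t * -w₁, by rw [map_mul, ht, div_mul_cancel₀ _ hw₁K]⟩
  · refine (mul_eq_zero.1 ?_).resolve_left (pow_ne_zero 2 hw₁K)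
    rw [← aeval_monicAssociate (⟨-w₁, 2 * w₂ - v₁, 2 * v₂ - w₃, -v₃⟩ : Cubic k),
      mul_div_cancel₀ _ hw₁K]
    simpa [monicAssociate, Cubic.toPoly] using hcubic

end DeloneFaddeev

section ReducedCubicForm

open Module

theorem exists_mul_eq_of_isReducedPair (k : Type*) [Field k] [NumberField k] :
    ∃ (N : ℕ) (C : ℝ), N ≠ 0 ∧ 0 ≤ C ∧ ∀ (K : Type*) [Field K] [NumberField K] [Algebra k K],
      finrank k K = 3 → ∀ {α β : 𝓞 K}, IsReducedPair k α β → ∀ x : 𝓞 K, ∃ u v w : 𝓞 k,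
        algebraMap k K N * x = algebraMap k K u + algebraMap k K v * α + algebraMap k K w * β ∧
        house (v : k) * house (α : K) ≤ C * house (x : K) ∧
        house (w : k) * house (β : K) ≤ C * house (x : K) := by
  classical
  set n := finrank ℚ k
  set H := ∑ i, house (integralBasis k i)
  have hH0 : 0 ≤ H := Finset.sum_nonneg fun _ _ => house_nonneg _
  set D : ℝ := (n * 3).factorial * (H ^ (n * 3) * 216 ^ n) with hD
  refine ⟨⌊D⌋₊.factorial, ⌊D⌋₊.factorial * (n * D), Nat.factorial_ne_zero _, by positivity, ?_⟩
  intro K _ _ _ h3 α β h x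
  let c := basisOfLinearIndependentOfCardEqFinrank h.linearIndependent (by simp [h3])
  have hc : ⇑c = ![1, (α : K), (β : K)] := coe_basisOfLinearIndependentOfCardEqFinrank _ _
  have hcard : Fintype.card (Free.ChooseBasisIndex ℤ (𝓞 k)) = n :=
    (finrank_eq_card_basis (integralBasis k)).symm
  obtain ⟨y, hy, hbound⟩ := exists_integral_coordinates (integralBasis k) (H := H) (D := D)
    (fun i => by rw [integralBasis_apply]; exact RingOfIntegers.isIntegral_coe _)
    (fun i => Finset.single_le_sum (fun i _ => house_nonneg (integralBasis k i))
      (Finset.mem_univ i)) c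
    (by
      intro j
      rw [hc]
      fin_cases j
      exacts [isIntegral_one, α.isIntegral_coe, β.isIntegral_coe])
    (by
      rw [hcard, Fintype.card_fin, hc, Fin.prod_univ_three, hD]
      have hone : house (1 : K) = 1 := by simpa using house_intCast (K := K) 1
      simp only [Matrix.cons_val_zero, Matrix.cons_val_one, Matrix.cons_val, hone, one_mul]
      rw [mul_assoc, mul_assoc]
      gcongr
      exact h.house_mul_house_pow_le h3) x
  rw [hcard] at hbound
  refine ⟨y 0, y 1, y 2, ?_, by simpa [hc] using hbound 1, by simpa [hc] using hbound 2⟩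
  rw [map_natCast, hy, Fin.sum_univ_three, hc]
  simp

/-- The coefficients of the integral cubic polynomial `P` have house at most those of `H`. -/
structure CoeffHouseLE {k : Type*} [Field k] [NumberField k] (P : Cubic (𝓞 k)) (H : Cubic ℝ) :
    Prop where
  a_le : house (P.a : k) ≤ H.a
  b_le : house (P.b : k) ≤ H.b
  c_le : house (P.c : k) ≤ H.c
  d_le : house (P.d : k) ≤ H.d

/-- The box of coefficients, up to the constant `C`, of the cubic polynomial attached to a basis
`1, α, β` of a cubic extension in which `α` and `β` have houses `x` and `y`. -/
noncomputable def coeffBox (C x y : ℝ) : Cubic ℝ :=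
  ⟨C * (x ^ 2 / y), C * x, C * y, C * (y ^ 2 / x)⟩

theorem house_two_mul_sub_le {k : Type*} [Field k] [NumberField k] {x y : 𝓞 k} {H : ℝ}
    (hx : house (x : k) ≤ H) (hy : house (y : k) ≤ H) :
    house ((2 * x - y : 𝓞 k) : k) ≤ 3 * H := by
  have h2 : house ((2 * x : 𝓞 k) : k) = 2 * house (x : k) := mod_cast house_nat_mul (x : k) 2
  have hsub : house ((2 * x - y : 𝓞 k) : k) ≤ house ((2 * x : 𝓞 k) : k) + house (y : k) :=
    house_sub_le _ _
  linarith

theorem coeffHouseLE_of_house_mul_le {k : Type*} [Field k] [NumberField k] {C x y : ℝ}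
    (hC : 0 ≤ C) (hx : 0 < x) (hy : 0 < y) {v₁ w₁ v₂ w₂ v₃ w₃ : 𝓞 k}
    (hv₁ : house (v₁ : k) * x ≤ C * (x * x)) (hw₁ : house (w₁ : k) * y ≤ C * (x * x))
    (hv₂ : house (v₂ : k) * x ≤ C * (x * y)) (hw₂ : house (w₂ : k) * y ≤ C * (x * y))
    (hv₃ : house (v₃ : k) * x ≤ C * (y * y)) (hw₃ : house (w₃ : k) * y ≤ C * (y * y)) :
    CoeffHouseLE ⟨-w₁, 2 * w₂ - v₁, 2 * v₂ - w₃, -v₃⟩ (coeffBox (3 * C) x y) := by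
  rw [← le_div_iff₀ hx] at hv₁ hv₂ hv₃
  rw [← le_div_iff₀ hy] at hw₁ hw₂ hw₃
  constructor
  · have hnonneg : 0 ≤ C * (x ^ 2 / y) := by positivity
    calc house ((-w₁ : 𝓞 k) : k) = house (w₁ : k) := house_neg _
      _ ≤ C * (x ^ 2 / y) := hw₁.trans_eq (by ring)
      _ ≤ 3 * C * (x ^ 2 / y) := by linarith
  · rw [coeffBox, mul_assoc 3 C x]
    refine house_two_mul_sub_le (hw₂.trans_eq ?_) (hv₁.trans_eq ?_) <;> field_simp
  · rw [coeffBox, mul_assoc 3 C y]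
    refine house_two_mul_sub_le (hv₂.trans_eq ?_) (hw₃.trans_eq ?_) <;> field_simp
  · have hnonneg : 0 ≤ C * (y ^ 2 / x) := by positivity
    calc house ((-v₃ : 𝓞 k) : k) = house (v₃ : k) := house_neg _
      _ ≤ C * (y ^ 2 / x) := hv₃.trans_eq (by ring)
      _ ≤ 3 * C * (y ^ 2 / x) := by linarith

theorem exists_isCubicGenerator_coeffHouseLE (k : Type*) [Field k] [NumberField k] :
    ∃ C : ℝ, 1 ≤ C ∧ ∀ (K : Type*) [Field K] [NumberField K] [Algebra k K], finrank k K = 3 →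
      ∃ x y : ℝ, 1 ≤ x ∧ x ≤ y ∧ (x * y) ^ finrank ℚ k ≤ C * √|(discr K : ℝ)| ∧
        ∃ (P : Cubic (𝓞 k)) (ρ : K), IsCubicGenerator (P.map (algebraMap (𝓞 k) k)) ρ ∧
          CoeffHouseLE P (coeffBox C x y) := by
  obtain ⟨N, C, hN, hC, hcoord⟩ := exists_mul_eq_of_isReducedPair k
  have h216 : (1 : ℝ) ≤ 216 ^ finrank ℚ k := one_le_pow₀ (by norm_num)
  refine ⟨3 * C + 216 ^ finrank ℚ k, by linarith, fun K _ _ _ h3 => ?_⟩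
  obtain ⟨α, β, h⟩ := exists_isReducedPair (k := k) (K := K) h3.ge
  have hα := zero_lt_one.trans_le h.one_le_house
  have hβ := hα.trans_le h.house_le
  have hααH : house ((α * α : 𝓞 K) : K) ≤ house (α : K) * house (α : K) := house_mul_le _ _
  have hαβH : house ((α * β : 𝓞 K) : K) ≤ house (α : K) * house (β : K) := house_mul_le _ _
  have hββH : house ((β * β : 𝓞 K) : K) ≤ house (β : K) * house (β : K) := house_mul_le _ _
  obtain ⟨u₁, v₁, w₁, hαα, hv₁, hw₁⟩ := hcoord K h3 h (α * α)
  obtain ⟨u₂, v₂, w₂, hαβ, hv₂, hw₂⟩ := hcoord K h3 h (α * β)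
  obtain ⟨u₃, v₃, w₃, hββ, hv₃, hw₃⟩ := hcoord K h3 h (β * β)
  obtain ⟨ρ, hρ⟩ := isCubicGenerator_of_mul_eq h3 h.linearIndependent
    (Nat.cast_ne_zero.2 hN) hαα hαβ hββ
  have hbox := coeffHouseLE_of_house_mul_le hC hα hβ
    (hv₁.trans (mul_le_mul_of_nonneg_left hααH hC)) (hw₁.trans (mul_le_mul_of_nonneg_left hααH hC))
    (hv₂.trans (mul_le_mul_of_nonneg_left hαβH hC)) (hw₂.trans (mul_le_mul_of_nonneg_left hαβH hC))
    (hv₃.trans (mul_le_mul_of_nonneg_left hββH hC)) (hw₃.trans (mul_le_mul_of_nonneg_left hββH hC))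
  have hle : 3 * C ≤ 3 * C + 216 ^ finrank ℚ k := by linarith
  refine ⟨house (α : K), house (β : K), h.one_le_house, h.house_le,
    (h.house_mul_house_pow_le h3).trans (by gcongr; linarith), _, ρ, ?_,
    hbox.a_le.trans ?_, hbox.b_le.trans ?_, hbox.c_le.trans ?_, hbox.d_le.trans ?_⟩
  · simpa only [Cubic.map, map_neg, map_sub, map_mul, map_ofNat] using hρ
  all_goals exact mul_le_mul_of_nonneg_right hle (by positivity)

end ReducedCubicForm

/-! ### Ramification -/

section Ramification

open Module Polynomial

/-- The prime `p` of `k` ramifies in `K`: it is divisible by the square of a prime of `K`. -/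
def IsRamifiedAt (k K : Type*) [Field k] [Field K] [Algebra k K] (p : Ideal (𝓞 k)) : Prop :=
  ∃ P : Ideal (𝓞 K), P.IsPrime ∧ P ^ 2 ∣ p.map (algebraMap (𝓞 k) (𝓞 K))

theorem comap_eq_of_sq_dvd_map {R S : Type*} [CommRing R] [CommRing S] [Algebra R S] {p : Ideal R}
    [hp : p.IsMaximal] {P : Ideal S} [hP : P.IsPrime] (h : P ^ 2 ∣ p.map (algebraMap R S)) :
    P.comap (algebraMap R S) = p :=
  (hp.eq_of_le (Ideal.comap_ne_top _ hP.ne_top) (Ideal.map_le_iff_le_comap.1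
    ((Ideal.le_of_dvd h).trans (Ideal.pow_le_self two_ne_zero)))).symm

variable {k K : Type*} [Field k] [Field K] [Algebra k K]

theorem IsCubicGenerator.exists_integral {P : Cubic (𝓞 k)} {ρ : K}
    (h : IsCubicGenerator (P.map (algebraMap (𝓞 k) k)) ρ) :
    ∃ x : 𝓞 K, (x : K) ∉ Set.range (algebraMap k K) ∧ aeval x (monicAssociate P).toPoly = 0 := by
  set a := algebraMap k K P.a with ha
  have ha0 : a ≠ 0 := (_root_.map_ne_zero _).2 h.leadingCoeff_ne_zero
  have hroot : aeval (a * ρ) (monicAssociate P).toPoly = 0 := by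
    have hmap := aeval_monicAssociate (P.map (algebraMap (𝓞 k) k)) ρ
    rwa [h.aeval_eq_zero, mul_zero, ← map_monicAssociate, Cubic.map_toPoly, aeval_map_algebraMap]
      at hmap
  have hint : IsIntegral ℤ (a * ρ) :=
    isIntegral_trans (R := ℤ) (A := 𝓞 k) _ ⟨_, Cubic.monic_of_a_eq_one rfl, hroot⟩
  obtain ⟨x, hx⟩ : ∃ x : 𝓞 K, (x : K) = a * ρ := ⟨⟨a * ρ, hint⟩, rfl⟩
  rw [← hx] at hroot
  refine ⟨x, ?_, ?_⟩
  · rintro ⟨t, ht⟩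
    refine h.notMem_range ⟨t / P.a, ?_⟩
    rw [map_div₀, ← ha]
    exact (div_eq_iff ha0).2 ((ht.trans hx).trans (mul_comm _ _))
  · apply RingOfIntegers.coe_injective (K := K)
    rwa [← aeval_algebraMap_apply, map_zero]

variable [NumberField K]

theorem dvd_differentIdeal_of_sq_dvd_map {p : Ideal (𝓞 k)} [p.IsMaximal] (hp0 : p ≠ ⊥)
    {P : Ideal (𝓞 K)} [P.IsPrime] (h : P ^ 2 ∣ p.map (algebraMap (𝓞 k) (𝓞 K))) :
    P ∣ differentIdeal ℤ (𝓞 K) := by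
  have hne : p.under ℤ ≠ ⊥ := Ideal.under_ne_bot ℤ hp0
  have : (p.under ℤ).IsMaximal := Ideal.IsMaximal.under ℤ p
  have hsq : P ^ 2 ∣ (p.under ℤ).map (algebraMap ℤ (𝓞 K)) := by
    refine h.trans ?_
    rw [IsScalarTower.algebraMap_eq ℤ (𝓞 k) (𝓞 K), ← Ideal.map_map]
    exact Ideal.dvd_iff_le.2 (Ideal.map_mono Ideal.map_comap_le)
  simpa using pow_sub_one_dvd_differentIdeal_aux ℤ ℚ K P two_ne_zero hne hsq

variable [NumberField k]

theorem minpoly_eq_toPoly_of_aeval_eq_zero (h3 : finrank k K = 3) {P : Cubic (𝓞 k)}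
    (hP : P.a = 1) {x : 𝓞 K} (hx : (x : K) ∉ Set.range (algebraMap k K))
    (hroot : aeval x P.toPoly = 0) : minpoly (𝓞 k) x = P.toPoly := by
  have : FiniteDimensional k K := Module.finite_of_finrank_pos (by omega)
  have hint : IsIntegral (𝓞 k) x := Algebra.IsIntegral.isIntegral x
  refine (eq_of_monic_of_dvd_of_natDegree_le (minpoly.monic hint) (Cubic.monic_of_a_eq_one hP)
    (minpoly.isIntegrallyClosed_dvd hint hroot) ?_).symm
  rw [Cubic.natDegree_of_a_ne_zero (hP ▸ one_ne_zero),
    ← (minpoly.monic hint).natDegree_map (algebraMap (𝓞 k) k),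
    ← minpoly.isIntegrallyClosed_eq_field_fractions k K hint]
  exact (h3.symm.trans (natDegree_minpoly_eq_finrank (h3 ▸ Nat.prime_three) hx).symm).le

theorem IsCubicGenerator.leadingCoeff_mem_or_discr_mem (h3 : finrank k K = 3) {P : Cubic (𝓞 k)}
    {ρ : K} (h : IsCubicGenerator (P.map (algebraMap (𝓞 k) k)) ρ) {p : Ideal (𝓞 k)}
    [hp : p.IsMaximal] (hp0 : p ≠ ⊥) (hram : IsRamifiedAt k K p) : P.a ∈ p ∨ P.discr ∈ p := by
  obtain ⟨𝔓, h𝔓, hsq⟩ := hram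
  obtain ⟨x, hx, hroot⟩ := h.exists_integral
  have hdifferent : aeval x (derivative (monicAssociate P).toPoly) ∈ 𝔓 := by
    rw [← minpoly_eq_toPoly_of_aeval_eq_zero h3 rfl hx hroot]
    have hdvd : 𝔓 ∣ differentIdeal (𝓞 k) (𝓞 K) := by
      simpa using pow_sub_one_dvd_differentIdeal_aux (𝓞 k) k K 𝔓 two_ne_zero hp0 hsq
    exact Ideal.le_of_dvd hdvd (aeval_derivative_mem_differentIdeal (𝓞 k) k K x
      (adjoin_eq_top_of_notMem_range (h3 ▸ Nat.prime_three) hx))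
  have hmem : P.a ^ 2 * P.discr ∈ p := by
    rw [← comap_eq_of_sq_dvd_map hsq, ← discr_monicAssociate]
    exact discr_mem_of_aeval_derivative_mem hroot hdifferent
  exact (hp.isPrime.mem_or_mem hmem).imp_left (hp.isPrime.mem_of_pow_mem 2)

theorem absNorm_le_absNorm_of_comap_eq {p : Ideal (𝓞 k)} {P : Ideal (𝓞 K)} (hP0 : P ≠ ⊥)
    (hP : P.comap (algebraMap (𝓞 k) (𝓞 K)) = p) : Ideal.absNorm p ≤ Ideal.absNorm P := by
  have : Finite (𝓞 K ⧸ P) := Ideal.finiteQuotientOfFreeOfNeBot P hP0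
  change Nat.card (𝓞 k ⧸ p) ≤ Nat.card (𝓞 K ⧸ P)
  exact Nat.card_le_card_of_injective (Ideal.quotientMap P (algebraMap (𝓞 k) (𝓞 K)) hP.ge)
    (Ideal.quotientMap_injective' hP.le)

theorem prod_absNorm_le_abs_discr {Q : Finset (Ideal (𝓞 k))} (hQ : ∀ p ∈ Q, Prime p)
    (hram : ∀ p ∈ Q, IsRamifiedAt k K p) :
    ((∏ p ∈ Q, Ideal.absNorm p : ℕ) : ℝ) ≤ |(discr K : ℝ)| := by
  classical
  choose! P hP hsq using hram
  have hmax : ∀ p ∈ Q, p.IsMaximal := fun p hp =>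
    (Ideal.isPrime_of_prime (hQ p hp)).isMaximal (hQ p hp).ne_zero
  have hcomap : ∀ p ∈ Q, (P p).comap (algebraMap (𝓞 k) (𝓞 K)) = p := fun p hp =>
    have := hmax p hp
    have := hP p hp
    comap_eq_of_sq_dvd_map (hsq p hp)
  have hP0 : ∀ p ∈ Q, P p ≠ ⊥ := fun p hp h => (hQ p hp).ne_zero <| by
    rw [← hcomap p hp, h]
    exact Ideal.comap_bot_of_injective _ (FaithfulSMul.algebraMap_injective _ _)
  have hprod : ∏ p ∈ Q, P p ∣ differentIdeal ℤ (𝓞 K) := by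
    refine Finset.prod_dvd_of_coprime (fun p hp p' hp' hne => ?_) fun p hp => ?_
    · have hm := (hP p hp).isMaximal (hP0 p hp)
      have hm' := (hP p' hp').isMaximal (hP0 p' hp')
      refine Ideal.isCoprime_iff_sup_eq.2 (hm.coprime_of_ne hm' fun h => hne ?_)
      rw [← hcomap p hp, ← hcomap p' hp', h]
    · have := hmax p hp
      have := hP p hp
      exact dvd_differentIdeal_of_sq_dvd_map (hQ p hp).ne_zero (hsq p hp)
  have hdvd : ∏ p ∈ Q, Ideal.absNorm (P p) ∣ (discr K).natAbs := by
    rw [← absNorm_differentIdeal K (𝓞 K), ← map_prod]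
    exact map_dvd Ideal.absNorm hprod
  have hle : ∏ p ∈ Q, Ideal.absNorm p ≤ (discr K).natAbs :=
    (Finset.prod_le_prod' fun p hp => absNorm_le_absNorm_of_comap_eq (hP0 p hp)
      (hcomap p hp)).trans (Nat.le_of_dvd (Int.natAbs_pos.2 (discr_ne_zero K)) hdvd)
  rw [← Int.cast_abs, ← Int.natCast_natAbs, Int.cast_natCast]
  exact_mod_cast hle

end Ramification

/-! ### Counting cubic forms -/

section Counting

open Module Polynomial

variable {k : Type*} [Field k] [NumberField k]

theorem one_le_absNorm_of_ne_zero {I : Ideal (𝓞 k)} (hI : I ≠ 0) : (1 : ℝ) ≤ Ideal.absNorm I :=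
  Nat.one_le_cast.2 (Nat.one_le_iff_ne_zero.2 (Ideal.absNorm_eq_zero_iff.not.2 hI))

theorem card_le_of_forall_sub_mem {I : Ideal (𝓞 k)} (hI : I ≠ ⊥) (s : Finset (𝓞 k)) {H : ℝ}
    (hH : 0 ≤ H) (hs : ∀ x ∈ s, house (x : k) ≤ H) (hsub : ∀ x ∈ s, ∀ y ∈ s, x - y ∈ I) :
    (s.card : ℝ) ≤ 4 ^ finrank ℚ k * (1 + H ^ finrank ℚ k / Ideal.absNorm I) := by
  have hn : finrank ℚ k ≠ 0 := finrank_pos.ne'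
  have hN : 0 < (Ideal.absNorm I : ℝ) := one_pos.trans_le (one_le_absNorm_of_ne_zero hI)
  set δ : ℝ := (Ideal.absNorm I : ℝ) ^ ((finrank ℚ k : ℝ)⁻¹)
  have hδ0 : 0 < δ := Real.rpow_pos_of_pos hN _
  have hδn : δ ^ finrank ℚ k = Ideal.absNorm I := Real.rpow_inv_natCast_pow hN.le hn
  have hsep (t : Finset (𝓞 k)) (hts : t ⊆ s)
      (ht : ∀ x ∈ t, ∀ y ∈ t, house (x - y : k) < δ) : t.card ≤ 1 := by
    refine Finset.card_le_one.2 fun x hx y hy => by_contra fun hxy => ?_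
    have hle := absNorm_le_house_pow (hsub x (hts hx) y (hts hy)) (sub_ne_zero.2 hxy)
    rw [← hδn, pow_le_pow_iff_left₀ hδ0.le (house_nonneg _) hn] at hle
    exact hle.not_gt (by simpa using ht x hx y hy)
  have hcount := card_le_mul_pow_finrank_of_house_le ⊤ s (fun x => (x : k)) 1 hH hδ0
    (fun _ _ => Submodule.mem_top) hs hsep
  rw [finrank_top, Nat.cast_one, one_mul] at hcount
  calc (s.card : ℝ) ≤ (1 + 2 * H / δ) ^ finrank ℚ k := hcount
    _ ≤ 2 ^ (finrank ℚ k - 1) * (1 ^ finrank ℚ k + (2 * H / δ) ^ finrank ℚ k) :=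
        add_pow_le zero_le_one (by positivity) _
    _ ≤ 2 ^ finrank ℚ k * (1 ^ finrank ℚ k + (2 * H / δ) ^ finrank ℚ k) := by
        gcongr
        exacts [one_le_two, Nat.sub_le _ _]
    _ = 2 ^ finrank ℚ k + 4 ^ finrank ℚ k * (H ^ finrank ℚ k / Ideal.absNorm I) := by
        rw [div_pow, mul_pow, hδn, show (4 : ℝ) = 2 * 2 by norm_num, mul_pow]
        ring
    _ ≤ 4 ^ finrank ℚ k + 4 ^ finrank ℚ k * (H ^ finrank ℚ k / Ideal.absNorm I) := by
        gcongr
        norm_num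
    _ = _ := by ring

theorem card_le_of_house_le (s : Finset (𝓞 k)) {H : ℝ} (hH : 1 ≤ H)
    (hs : ∀ x ∈ s, house (x : k) ≤ H) :
    (s.card : ℝ) ≤ 2 * 4 ^ finrank ℚ k * H ^ finrank ℚ k := by
  have hcount := card_le_of_forall_sub_mem (I := ⊤) top_ne_bot s (by linarith) hs (by simp)
  rw [Ideal.absNorm_top, Nat.cast_one, div_one] at hcount
  calc (s.card : ℝ) ≤ 4 ^ finrank ℚ k * (1 + H ^ finrank ℚ k) := hcount
    _ ≤ 4 ^ finrank ℚ k * (H ^ finrank ℚ k + H ^ finrank ℚ k) := by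
        gcongr
        exact one_le_pow₀ hH
    _ = 2 * 4 ^ finrank ℚ k * H ^ finrank ℚ k := by ring

theorem card_le_of_forall_mem_of_ne_zero {I : Ideal (𝓞 k)} (hI : I ≠ ⊥) (s : Finset (𝓞 k)) {H : ℝ}
    (hH : 0 ≤ H) (hs : ∀ x ∈ s, house (x : k) ≤ H) (hmem : ∀ x ∈ s, x ∈ I) (h0 : ∀ x ∈ s, x ≠ 0) :
    (s.card : ℝ) ≤ 2 * 4 ^ finrank ℚ k * (H ^ finrank ℚ k / Ideal.absNorm I) := by
  have hN : 0 < (Ideal.absNorm I : ℝ) := one_pos.trans_le (one_le_absNorm_of_ne_zero hI)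
  obtain rfl | ⟨x, hx⟩ := s.eq_empty_or_nonempty
  · rw [Finset.card_empty, Nat.cast_zero]
    positivity
  have hle : 1 ≤ H ^ finrank ℚ k / Ideal.absNorm I := (one_le_div hN).2 <|
    (absNorm_le_house_pow (hmem x hx) (h0 x hx)).trans
      (pow_le_pow_left₀ (house_nonneg _) (hs x hx) _)
  calc (s.card : ℝ) ≤ 4 ^ finrank ℚ k * (1 + H ^ finrank ℚ k / Ideal.absNorm I) :=
        card_le_of_forall_sub_mem hI s hH hs fun x hx y hy => sub_mem (hmem x hx) (hmem y hy)
    _ ≤ 4 ^ finrank ℚ k * (H ^ finrank ℚ k / Ideal.absNorm I +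
          H ^ finrank ℚ k / Ideal.absNorm I) := by gcongr
    _ = 2 * 4 ^ finrank ℚ k * (H ^ finrank ℚ k / Ideal.absNorm I) := by ring

theorem mem_prod_of_forall_mem {R : Type*} [CommRing R] [IsDedekindDomain R]
    {Q : Finset (Ideal R)} (hQ : ∀ p ∈ Q, Prime p) {x : R} (hx : ∀ p ∈ Q, x ∈ p) :
    x ∈ ∏ p ∈ Q, p :=
  Ideal.dvd_span_singleton.1 <|
    Finset.prod_primes_dvd _ hQ fun p hp => Ideal.dvd_span_singleton.2 (hx p hp)

theorem card_le_pow_mul_of_card_image_quotient_le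
    [∀ p : Ideal (𝓞 k), DecidableEq (𝓞 k ⧸ p)] {Q : Finset (Ideal (𝓞 k))} (hQ : ∀ p ∈ Q, Prime p)
    (s : Finset (𝓞 k)) {m : ℕ} (hm : ∀ p ∈ Q, (s.image (Ideal.Quotient.mk p)).card ≤ m) {H : ℝ}
    (hH : 0 ≤ H) (hs : ∀ x ∈ s, house (x : k) ≤ H) :
    (s.card : ℝ) ≤ m ^ Q.card *
      (4 ^ finrank ℚ k * (1 + H ^ finrank ℚ k / Ideal.absNorm (∏ p ∈ Q, p))) := by
  classical
  let g : 𝓞 k → ∀ p ∈ Q, 𝓞 k ⧸ p := fun x p _ => Ideal.Quotient.mk p x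
  have himage : (s.image g).card ≤ m ^ Q.card := by
    have hsub : s.image g ⊆ Q.pi fun p => s.image (Ideal.Quotient.mk p) := fun f hf => by
      obtain ⟨x, hx, rfl⟩ := Finset.mem_image.1 hf
      exact Finset.mem_pi.2 fun p _ => Finset.mem_image_of_mem _ hx
    refine (Finset.card_le_card hsub).trans ?_
    rw [Finset.card_pi]
    exact Finset.prod_le_pow_card _ _ _ hm
  have hfiber (f) : ((s.filter fun x => g x = f).card : ℝ) ≤
      4 ^ finrank ℚ k * (1 + H ^ finrank ℚ k / Ideal.absNorm (∏ p ∈ Q, p)) := by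
    refine card_le_of_forall_sub_mem (Finset.prod_ne_zero_iff.2 fun p hp => (hQ p hp).ne_zero) _ hH
      (fun x hx => hs x (Finset.mem_filter.1 hx).1) fun x hx y hy => ?_
    refine mem_prod_of_forall_mem hQ fun p hp => Ideal.Quotient.eq.1 ?_
    have hxy := (Finset.mem_filter.1 hx).2.trans (Finset.mem_filter.1 hy).2.symm
    exact congrFun (congrFun hxy p) hp
  rw [Finset.card_eq_sum_card_image g s, Nat.cast_sum]
  refine (Finset.sum_le_card_nsmul _ _ _ fun f _ => hfiber f).trans ?_
  rw [nsmul_eq_mul]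
  gcongr
  exact_mod_cast himage

theorem card_le_two_of_quadratic_eq_zero {F : Type*} [Field F] (s : Finset F) {r : F} (u v : F)
    (hr : r ≠ 0) (hs : ∀ x ∈ s, r * x ^ 2 + u * x + v = 0) : s.card ≤ 2 := by
  have hdeg : (C r * X ^ 2 + C u * X + C v).natDegree = 2 := natDegree_quadratic hr
  have hne : C r * X ^ 2 + C u * X + C v ≠ 0 := fun h => by simp [h] at hdeg
  refine hdeg ▸ card_le_degree_of_subset_roots fun x hx => (mem_roots hne).2 ?_
  simpa [IsRoot] using hs x hx

theorem card_image_quotient_le_two_of_discr_mem {R : Type*} [CommRing R] {p : Ideal R}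
    [DecidableEq (R ⧸ p)] [hp : p.IsMaximal] (h3 : (3 : R) ∉ p) {a : R} (ha : a ∉ p) (b c : R)
    (s : Finset R) (hs : ∀ d ∈ s, (⟨a, b, c, d⟩ : Cubic R).discr ∈ p) :
    (s.image (Ideal.Quotient.mk p)).card ≤ 2 := by
  let _ : Field (R ⧸ p) := Ideal.Quotient.field p
  let m := Ideal.Quotient.mk p
  refine card_le_two_of_quadratic_eq_zero (r := m (-(3 ^ 3 * a ^ 2))) _
    (m (18 * a * b * c - 4 * b ^ 3)) (m (b ^ 2 * c ^ 2 - 4 * a * c ^ 3)) ?_ fun x hx => ?_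
  · rw [Ne, Ideal.Quotient.eq_zero_iff_mem, neg_mem_iff]
    intro hmem
    rcases hp.isPrime.mem_or_mem hmem with h | h
    · exact h3 (hp.isPrime.mem_of_pow_mem 3 h)
    · exact ha (hp.isPrime.mem_of_pow_mem 2 h)
  · obtain ⟨d, hd, rfl⟩ := Finset.mem_image.1 hx
    rw [← Ideal.Quotient.eq_zero_iff_mem.2 (hs d hd)]
    simp only [m, ← map_pow, ← map_mul, ← map_add, Cubic.discr]
    congr 1
    ring

theorem one_le_absNorm_prod {Q : Finset (Ideal (𝓞 k))} (hQ : ∀ p ∈ Q, Prime p) :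
    (1 : ℝ) ≤ Ideal.absNorm (∏ p ∈ Q, p) :=
  one_le_absNorm_of_ne_zero <| Finset.prod_ne_zero_iff.2 fun p hp => (hQ p hp).ne_zero

theorem card_le_of_leadingCoeff_mem_or_discr_mem
    [∀ p : Ideal (𝓞 k), DecidablePred (· ∈ p)] {Q : Finset (Ideal (𝓞 k))}
    (hQ : ∀ p ∈ Q, Prime p) (h3 : ∀ p ∈ Q, (3 : 𝓞 k) ∉ p) (a b c : 𝓞 k) (s : Finset (𝓞 k)) {H : ℝ}
    (hH : 0 ≤ H) (hs : ∀ d ∈ s, house (d : k) ≤ H)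
    (hdiscr : ∀ d ∈ s, ∀ p ∈ Q, a ∈ p ∨ (⟨a, b, c, d⟩ : Cubic (𝓞 k)).discr ∈ p) :
    (s.card : ℝ) ≤ 2 ^ Q.card * (4 ^ finrank ℚ k * (1 + H ^ finrank ℚ k /
      Ideal.absNorm (∏ p ∈ Q, p) * Ideal.absNorm (∏ p ∈ Q with a ∈ p, p))) := by
  classical
  have hsub : (Q.filter fun p => a ∉ p) ⊆ Q := Finset.filter_subset _ _
  have hcount := card_le_pow_mul_of_card_image_quotient_le (fun p hp => hQ p (hsub hp)) s (m := 2)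
    (fun p hp => by
      have := (Ideal.isPrime_of_prime (hQ p (hsub hp))).isMaximal (hQ p (hsub hp)).ne_zero
      exact card_image_quotient_le_two_of_discr_mem (h3 p (hsub hp)) (Finset.mem_filter.1 hp).2 b c
        s fun d hd => (hdiscr d hd p (hsub hp)).resolve_left (Finset.mem_filter.1 hp).2) hH hs
  have hsplit : (Ideal.absNorm (∏ p ∈ Q, p) : ℝ) = Ideal.absNorm (∏ p ∈ Q with a ∈ p, p) *
      Ideal.absNorm (∏ p ∈ Q with a ∉ p, p) := by
    rw [← Finset.prod_filter_mul_prod_filter_not Q (a ∈ ·), map_mul, Nat.cast_mul]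
  have hdvd_ne : (Ideal.absNorm (∏ p ∈ Q with a ∈ p, p) : ℝ) ≠ 0 :=
    (zero_lt_one.trans_le (one_le_absNorm_prod fun p hp => hQ p (Finset.mem_filter.1 hp).1)).ne'
  rw [hsplit, div_mul_eq_mul_div, mul_comm (H ^ _), mul_div_mul_left _ _ hdvd_ne]
  refine hcount.trans ?_
  rw [Nat.cast_ofNat]
  gcongr
  exact one_le_two

theorem card_le_of_forall_coeff_eq
    [∀ p : Ideal (𝓞 k), DecidablePred (· ∈ p)] {Q : Finset (Ideal (𝓞 k))}
    (hQ : ∀ p ∈ Q, Prime p) (h3 : ∀ p ∈ Q, (3 : 𝓞 k) ∉ p) {a b c : 𝓞 k} (T : Finset (Cubic (𝓞 k)))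
    (hT : ∀ P ∈ T, P.a = a ∧ P.b = b ∧ P.c = c) {H : ℝ} (hH : 0 ≤ H)
    (hd : ∀ P ∈ T, house (P.d : k) ≤ H) (hdiscr : ∀ P ∈ T, ∀ p ∈ Q, P.a ∈ p ∨ P.discr ∈ p) :
    (T.card : ℝ) ≤ 2 ^ Q.card * (4 ^ finrank ℚ k * (1 + H ^ finrank ℚ k /
      Ideal.absNorm (∏ p ∈ Q, p) * Ideal.absNorm (∏ p ∈ Q with a ∈ p, p))) := by
  classical
  have hmk (P) (hP : P ∈ T) : P = ⟨a, b, c, P.d⟩ :=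
    Cubic.ext (hT P hP).1 (hT P hP).2.1 (hT P hP).2.2 rfl
  rw [← Finset.card_image_of_injOn (f := Cubic.d) fun P hP P' hP' h => by
    rw [hmk P hP, hmk P' hP', h]]
  refine card_le_of_leadingCoeff_mem_or_discr_mem hQ h3 a b c _ hH (Finset.forall_mem_image.2 hd)
    (Finset.forall_mem_image.2 fun P hP => ?_)
  have hP' := hdiscr P hP
  rwa [hmk P hP] at hP'

theorem sum_one_add_mul_absNorm_le
    [∀ p : Ideal (𝓞 k), DecidablePred (· ∈ p)] {Q : Finset (Ideal (𝓞 k))}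
    (hQ : ∀ p ∈ Q, Prime p) (s : Finset (𝓞 k)) (h0 : ∀ a ∈ s, a ≠ 0) {H : ℝ} (hH : 0 ≤ H)
    (hs : ∀ a ∈ s, house (a : k) ≤ H) {y : ℝ} (hy : 0 ≤ y) :
    ∑ a ∈ s, (1 + y * Ideal.absNorm (∏ p ∈ Q with a ∈ p, p)) ≤
      2 ^ Q.card * (2 * 4 ^ finrank ℚ k * H ^ finrank ℚ k * (1 + y)) := by
  classical
  have hfiber (R : Finset (Ideal (𝓞 k))) (hR : R ∈ Q.powerset) :
      ∑ a ∈ s with {p ∈ Q | a ∈ p} = R, (1 + y * Ideal.absNorm (∏ p ∈ Q with a ∈ p, p)) ≤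
        2 * 4 ^ finrank ℚ k * H ^ finrank ℚ k * (1 + y) := by
    have hRQ : ∀ p ∈ R, Prime p := fun p hp => hQ p (Finset.mem_powerset.1 hR hp)
    have hN := one_le_absNorm_prod hRQ
    have hcard := card_le_of_forall_mem_of_ne_zero
      (Finset.prod_ne_zero_iff.2 fun p hp => (hRQ p hp).ne_zero)
      (s.filter fun a => {p ∈ Q | a ∈ p} = R) hH (fun a ha => hs a (Finset.mem_filter.1 ha).1)
      (fun a ha => mem_prod_of_forall_mem hRQ fun p hp => by
        rw [← (Finset.mem_filter.1 ha).2] at hp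
        exact (Finset.mem_filter.1 hp).2) fun a ha => h0 a (Finset.mem_filter.1 ha).1
    calc ∑ a ∈ s with {p ∈ Q | a ∈ p} = R, (1 + y * Ideal.absNorm (∏ p ∈ Q with a ∈ p, p))
        = (s.filter fun a => {p ∈ Q | a ∈ p} = R).card *
            (1 + y * Ideal.absNorm (∏ p ∈ R, p)) := by
          rw [← nsmul_eq_mul, ← Finset.sum_const]
          exact Finset.sum_congr rfl fun a ha => by rw [(Finset.mem_filter.1 ha).2]
      _ ≤ 2 * 4 ^ finrank ℚ k * (H ^ finrank ℚ k / Ideal.absNorm (∏ p ∈ R, p)) *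
            (Ideal.absNorm (∏ p ∈ R, p) + y * Ideal.absNorm (∏ p ∈ R, p)) := by gcongr
      _ = 2 * 4 ^ finrank ℚ k * H ^ finrank ℚ k * (1 + y) := by
          have := zero_lt_one.trans_le hN
          field_simp
  rw [← Finset.sum_fiberwise_of_maps_to (t := Q.powerset) (g := fun a => {p ∈ Q | a ∈ p})
    fun a _ => Finset.mem_powerset.2 (Finset.filter_subset _ _)]
  refine (Finset.sum_le_card_nsmul _ _ _ hfiber).trans_eq ?_
  rw [Finset.card_powerset, nsmul_eq_mul, Nat.cast_pow, Nat.cast_ofNat]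

theorem card_le_of_coeffHouseLE {Q : Finset (Ideal (𝓞 k))} (hQ : ∀ p ∈ Q, Prime p)
    (h3 : ∀ p ∈ Q, (3 : 𝓞 k) ∉ p) (T : Finset (Cubic (𝓞 k))) {H : Cubic ℝ} (ha : 0 ≤ H.a)
    (hb : 1 ≤ H.b) (hc : 1 ≤ H.c) (hd : 0 ≤ H.d) (h0 : ∀ P ∈ T, P.a ≠ 0)
    (hT : ∀ P ∈ T, CoeffHouseLE P H) (hdiscr : ∀ P ∈ T, ∀ p ∈ Q, P.a ∈ p ∨ P.discr ∈ p) :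
    (T.card : ℝ) ≤ 8 * 256 ^ finrank ℚ k * 4 ^ Q.card * (H.a * H.b * H.c) ^ finrank ℚ k *
      (1 + H.d ^ finrank ℚ k / Ideal.absNorm (∏ p ∈ Q, p)) := by
  classical
  set n := finrank ℚ k
  set y := H.d ^ n / Ideal.absNorm (∏ p ∈ Q, p) with hy
  have hy0 : 0 ≤ y := by positivity
  have hB : ((T.image Cubic.b).card : ℝ) ≤ 2 * 4 ^ n * H.b ^ n :=
    card_le_of_house_le _ hb (Finset.forall_mem_image.2 fun P hP => (hT P hP).b_le)
  have hC : ((T.image Cubic.c).card : ℝ) ≤ 2 * 4 ^ n * H.c ^ n :=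
    card_le_of_house_le _ hc (Finset.forall_mem_image.2 fun P hP => (hT P hP).c_le)
  have hA := sum_one_add_mul_absNorm_le hQ (T.image Cubic.a) (Finset.forall_mem_image.2 h0) ha
    (Finset.forall_mem_image.2 fun P hP => (hT P hP).a_le) hy0
  have hfiber (t : 𝓞 k × 𝓞 k × 𝓞 k) : ((T.filter fun P => (P.a, P.b, P.c) = t).card : ℝ) ≤
      2 ^ Q.card * (4 ^ n * (1 + y * Ideal.absNorm (∏ p ∈ Q with t.1 ∈ p, p))) := by
    have hmem : ∀ P ∈ T.filter fun P => (P.a, P.b, P.c) = t, P ∈ T ∧ P.a = t.1 ∧ P.b = t.2.1 ∧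
        P.c = t.2.2 := by
      simp +contextual [Prod.ext_iff]
    exact card_le_of_forall_coeff_eq hQ h3 _ (fun P hP => (hmem P hP).2) hd
      (fun P hP => (hT P (hmem P hP).1).d_le) fun P hP => hdiscr P (hmem P hP).1
  have hmaps : ∀ P ∈ T, (P.a, P.b, P.c) ∈
      T.image Cubic.a ×ˢ T.image Cubic.b ×ˢ T.image Cubic.c := fun P hP =>
    Finset.mk_mem_product (Finset.mem_image_of_mem _ hP) (Finset.mk_mem_product
      (Finset.mem_image_of_mem _ hP) (Finset.mem_image_of_mem _ hP))
  rw [Finset.card_eq_sum_card_fiberwise hmaps, Nat.cast_sum]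
  calc ∑ t ∈ T.image Cubic.a ×ˢ T.image Cubic.b ×ˢ T.image Cubic.c,
        ((T.filter fun P => (P.a, P.b, P.c) = t).card : ℝ)
      ≤ ∑ t ∈ T.image Cubic.a ×ˢ T.image Cubic.b ×ˢ T.image Cubic.c,
          2 ^ Q.card * (4 ^ n * (1 + y * Ideal.absNorm (∏ p ∈ Q with t.1 ∈ p, p))) :=
        Finset.sum_le_sum fun t _ => hfiber t
    _ = 2 ^ Q.card * 4 ^ n * (((T.image Cubic.b).card * (T.image Cubic.c).card) *
          ∑ a ∈ T.image Cubic.a, (1 + y * Ideal.absNorm (∏ p ∈ Q with a ∈ p, p))) := by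
        rw [Finset.sum_product]
        simp only [Finset.sum_const, Finset.card_product, nsmul_eq_mul, ← Finset.mul_sum,
          Nat.cast_mul]
        ring
    _ ≤ 2 ^ Q.card * 4 ^ n * ((2 * 4 ^ n * H.b ^ n * (2 * 4 ^ n * H.c ^ n)) *
          (2 ^ Q.card * (2 * 4 ^ n * H.a ^ n * (1 + y)))) := by
        gcongr
    _ = 8 * 256 ^ n * 4 ^ Q.card * (H.a * H.b * H.c) ^ n * (1 + y) := by
        rw [show (256 : ℝ) = 4 * 4 * 4 * 4 by norm_num,
          show (4 : ℝ) ^ Q.card = (2 * 2) ^ Q.card by norm_num]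
        simp only [mul_pow]
        ring

end Counting

/-! ### Families of cubic forms attached to one field -/

section DyadicFamily

open Module

/-- The polynomial `P(X + m)`. -/
def cubicTranslate {R : Type*} [CommRing R] (P : Cubic R) (m : R) : Cubic R :=
  ⟨P.a, P.b + 3 * P.a * m, P.c + 2 * P.b * m + 3 * P.a * m ^ 2,
    P.d + P.c * m + P.b * m ^ 2 + P.a * m ^ 3⟩

theorem cubicTranslate_injective {R : Type*} [CommRing R] [IsDomain R] [CharZero R] {P : Cubic R}
    (ha : P.a ≠ 0) : Function.Injective (cubicTranslate P) := fun _ _ h =>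
  mul_left_cancel₀ (mul_ne_zero (OfNat.ofNat_ne_zero 3) ha) (add_left_cancel (congrArg Cubic.b h))

theorem map_cubicTranslate {R S : Type*} [CommRing R] [CommRing S] (f : R →+* S) (P : Cubic R)
    (m : R) : (cubicTranslate P m).map f = cubicTranslate (P.map f) (f m) := by
  simp only [cubicTranslate, Cubic.map, map_add, map_mul, map_pow, map_ofNat]

theorem isCubicGenerator_cubicTranslate {k K : Type*} [Field k] [Field K] [Algebra k K]
    {P : Cubic k} {ρ : K} (h : IsCubicGenerator P ρ) (m : k) :
    IsCubicGenerator (cubicTranslate P m) (ρ - algebraMap k K m) where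
  leadingCoeff_ne_zero := h.leadingCoeff_ne_zero
  notMem_range := fun ⟨x, hx⟩ => h.notMem_range ⟨x + m, by rw [map_add, hx, sub_add_cancel]⟩
  aeval_eq_zero := by
    have hroot := h.aeval_eq_zero
    simp only [cubicTranslate, Cubic.toPoly, map_add, map_mul, map_pow, map_ofNat,
      Polynomial.aeval_C, Polynomial.aeval_X] at hroot ⊢
    linear_combination hroot

section House

variable {k : Type*} [Field k] [NumberField k]

theorem house_natCast_mul_mul_pow_le {x m : 𝓞 k} {A M : ℝ} (hx : house (x : k) ≤ A)
    (hm : house (m : k) ≤ M) (n e : ℕ) :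
    house ((n * x * m ^ e : 𝓞 k) : k) ≤ n * (A * M ^ e) := by
  have hm0 : 0 ≤ house (m : k) := house_nonneg _
  have hM : house (m : k) ^ e ≤ M ^ e := pow_le_pow_left₀ hm0 hm e
  have hA : 0 ≤ A := (house_nonneg _).trans hx
  calc house ((n * x * m ^ e : 𝓞 k) : k) = house ((n : k) * (x * (m : k) ^ e)) := by
        push_cast [mul_assoc]; rfl
    _ = n * house (x * (m : k) ^ e) := house_nat_mul _ _
    _ ≤ n * (house (x : k) * house (m : k) ^ e) := by
        gcongr
        exact (house_mul_le _ _).trans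
          (mul_le_mul_of_nonneg_left (house_pow_le _ _) (house_nonneg _))
    _ ≤ n * (A * M ^ e) := by
        gcongr

theorem coeffHouseLE_cubicTranslate {P : Cubic (𝓞 k)} {C x y : ℝ} (hC : 0 ≤ C) (hx : 0 < x)
    (hy : 0 < y) (h : CoeffHouseLE P (coeffBox C x y)) {m : 𝓞 k} (hm : house (m : k) ≤ y / x) :
    CoeffHouseLE (cubicTranslate P m) (coeffBox (6 * C) x y) := by
  have hadd (u v : 𝓞 k) : house ((u + v : 𝓞 k) : k) ≤ house (u : k) + house (v : k) :=
    house_add_le _ _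
  obtain ⟨ha₀, hb₀, hc₀, hd₀⟩ := h
  have hb₃ := house_natCast_mul_mul_pow_le ha₀ hm 3 1
  have hc₂ := house_natCast_mul_mul_pow_le hb₀ hm 2 1
  have hc₃ := house_natCast_mul_mul_pow_le ha₀ hm 3 2
  have hd₁ := house_natCast_mul_mul_pow_le hc₀ hm 1 1
  have hd₂ := house_natCast_mul_mul_pow_le hb₀ hm 1 2
  have hd₃ := house_natCast_mul_mul_pow_le ha₀ hm 1 3
  simp only [coeffBox, Nat.cast_ofNat, Nat.cast_one, one_mul, pow_one] at *
  have hX : 0 ≤ C * x := by positivity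
  have hY : 0 ≤ C * y := by positivity
  have hD : 0 ≤ C * (y ^ 2 / x) := by positivity
  have ha₁ : C * (x ^ 2 / y) * (y / x) = C * x := by field_simp
  have ha₂ : C * (x ^ 2 / y) * (y / x) ^ 2 = C * y := by field_simp
  have ha₃ : C * (x ^ 2 / y) * (y / x) ^ 3 = C * (y ^ 2 / x) := by field_simp
  have hb₁ : C * x * (y / x) = C * y := by field_simp
  have hb₂ : C * x * (y / x) ^ 2 = C * (y ^ 2 / x) := by field_simp
  have hc₁ : C * y * (y / x) = C * (y ^ 2 / x) := by field_simp
  constructor <;> simp only [cubicTranslate]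
  · have hA : 0 ≤ C * (x ^ 2 / y) := by positivity
    linarith [ha₀]
  · linarith [hadd P.b (3 * P.a * m), hb₀]
  · linarith [hadd (P.c + 2 * P.b * m) (3 * P.a * m ^ 2), hadd P.c (2 * P.b * m), hc₀]
  · linarith [hadd (P.d + P.c * m + P.b * m ^ 2) (P.a * m ^ 3),
      hadd (P.d + P.c * m) (P.b * m ^ 2), hadd P.d (P.c * m), hd₀]

theorem coeffHouseLE_coeffBox_of_le {P : Cubic (𝓞 k)} {C C' x x' y y' : ℝ} (hC : 0 ≤ C)
    (hCC' : 4 * C ≤ C') (hx' : 0 < x') (hy' : 0 < y') (hxx' : x' ≤ x) (hyy' : y' ≤ y)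
    (hx2 : x ≤ 2 * x') (hy2 : y ≤ 2 * y') (h : CoeffHouseLE P (coeffBox C x y)) :
    CoeffHouseLE P (coeffBox C' x' y') := by
  have hx : 0 ≤ x := hx'.le.trans hxx'
  have hy : 0 ≤ y := hy'.le.trans hyy'
  refine ⟨h.a_le.trans ?_, h.b_le.trans ?_, h.c_le.trans ?_, h.d_le.trans ?_⟩ <;>
    simp only [coeffBox]
  · calc C * (x ^ 2 / y) ≤ C * ((2 * x') ^ 2 / y') := by gcongr
      _ = 4 * C * (x' ^ 2 / y') := by ring
      _ ≤ C' * (x' ^ 2 / y') := by gcongr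
  · calc C * x ≤ C * (2 * x') := by gcongr
      _ ≤ 4 * C * x' := by linarith [mul_nonneg hC hx'.le]
      _ ≤ C' * x' := by gcongr
  · calc C * y ≤ C * (2 * y') := by gcongr
      _ ≤ 4 * C * y' := by linarith [mul_nonneg hC hy'.le]
      _ ≤ C' * y' := by gcongr
  · calc C * (y ^ 2 / x) ≤ C * ((2 * y') ^ 2 / x') := by gcongr
      _ = 4 * C * (y' ^ 2 / x') := by ring
      _ ≤ C' * (y' ^ 2 / x') := by gcongr

end House

theorem IsCubicGenerator.a_ne_zero {k K : Type*} [Field k] [Field K] [Algebra k K]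
    {P : Cubic (𝓞 k)} {ρ : K} (h : IsCubicGenerator (P.map (algebraMap (𝓞 k) k)) ρ) : P.a ≠ 0 :=
  fun ha => h.leadingCoeff_ne_zero (by simp only [Cubic.map, ha, map_zero])

theorem exists_finset_isCubicGenerator {k K : Type*} [Field k] [NumberField k] [Field K]
    [Algebra k K] {P : Cubic (𝓞 k)} {ρ : K} {C x y : ℝ} (hC : 0 ≤ C) (hx : 0 < x) (hy : 0 < y)
    (hρ : IsCubicGenerator (P.map (algebraMap (𝓞 k) k)) ρ)
    (hP : CoeffHouseLE P (coeffBox C x y)) :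
    ∃ F : Finset (Cubic (𝓞 k)),
      (y / x) ^ finrank ℚ k ≤ 2 ^ finrank ℚ k * √|(discr k : ℝ)| * F.card ∧
      ∀ P' ∈ F, CoeffHouseLE P' (coeffBox (6 * C) x y) ∧
        ∃ ρ' : K, IsCubicGenerator (P'.map (algebraMap (𝓞 k) k)) ρ' := by
  classical
  set M := (finite_setOf_house_lt k (2 * (y / x / 2))).toFinset with hM
  refine ⟨M.image (cubicTranslate P), ?_, fun P' hP' => ?_⟩
  · have hcount := pow_finrank_le_ncard_mul_sqrt_discr k (r := y / x / 2) (by positivity)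
    rw [Set.ncard_eq_toFinset_card _ (finite_setOf_house_lt k _), ← hM] at hcount
    rw [Finset.card_image_of_injective _ (cubicTranslate_injective hρ.a_ne_zero)]
    calc (y / x) ^ finrank ℚ k = 2 ^ finrank ℚ k * (y / x / 2) ^ finrank ℚ k := by
          rw [← mul_pow]
          congr 1
          ring
      _ ≤ 2 ^ finrank ℚ k * (M.card * √|(discr k : ℝ)|) := by gcongr
      _ = _ := by ring
  · obtain ⟨m, hm, rfl⟩ := Finset.mem_image.1 hP'
    refine ⟨coeffHouseLE_cubicTranslate hC hx hy hP ?_, ρ - algebraMap k K m, ?_⟩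
    · simp only [hM, Set.Finite.mem_toFinset, Set.mem_ofPred_eq] at hm
      linarith
    · rw [map_cubicTranslate]
      exact isCubicGenerator_cubicTranslate hρ _

theorem exists_dyadic_finset_isCubicGenerator (k : Type*) [Field k] [NumberField k] :
    ∃ C : ℝ, 1 ≤ C ∧ ∀ (K : Type*) [Field K] [NumberField K] [Algebra k K], finrank k K = 3 →
      ∃ i t : ℕ, ((2 : ℝ) ^ i * 2 ^ (i + t)) ^ finrank ℚ k ≤ C * √|(discr K : ℝ)| ∧
        ∃ F : Finset (Cubic (𝓞 k)), ((2 : ℝ) ^ (i + t) / 2 ^ i) ^ finrank ℚ k ≤ C * F.card ∧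
          ∀ P ∈ F, CoeffHouseLE P (coeffBox C (2 ^ i) (2 ^ (i + t))) ∧
            ∃ ρ : K, IsCubicGenerator (P.map (algebraMap (𝓞 k) k)) ρ := by
  obtain ⟨C, hC, hform⟩ := exists_isCubicGenerator_coeffHouseLE k
  have hC0 : 0 ≤ C := zero_le_one.trans hC
  set S := 2 ^ finrank ℚ k * √|(discr k : ℝ)|
  have hS0 : 0 ≤ S := by positivity
  refine ⟨6 * (4 * C + S), by linarith, fun K _ _ _ h3 => ?_⟩
  obtain ⟨x, y, hx, hxy, hvol, P, ρ, hρ, hP⟩ := hform K h3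
  obtain ⟨i, hix, hxi⟩ := exists_nat_pow_near hx (one_lt_two (α := ℝ))
  obtain ⟨j, hjy, hyj⟩ := exists_nat_pow_near (hx.trans hxy) (one_lt_two (α := ℝ))
  rw [pow_succ'] at hxi hyj
  have hij : i ≤ j := by
    refine Nat.lt_succ_iff.1 ((pow_lt_pow_iff_right₀ (one_lt_two (α := ℝ))).1 ?_)
    rw [pow_succ']
    exact (hix.trans hxy).trans_lt hyj
  obtain ⟨t, rfl⟩ := Nat.exists_eq_add_of_le hij
  obtain ⟨F, hcard, hF⟩ := exists_finset_isCubicGenerator (C := 4 * C + S) (by positivity)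
    (pow_pos two_pos i) (pow_pos two_pos (i + t)) hρ
    (coeffHouseLE_coeffBox_of_le hC0 (by linarith) (by positivity) (by positivity)
      hix hjy hxi.le hyj.le hP)
  refine ⟨i, t, ?_, F, ?_, hF⟩
  · calc ((2 : ℝ) ^ i * 2 ^ (i + t)) ^ finrank ℚ k ≤ (x * y) ^ finrank ℚ k := by gcongr
      _ ≤ C * √|(discr K : ℝ)| := hvol
      _ ≤ 6 * (4 * C + S) * √|(discr K : ℝ)| := by gcongr; linarith
  · exact hcard.trans (mul_le_mul_of_nonneg_right (by linarith) (Nat.cast_nonneg _))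

end DyadicFamily

section Summation

open Module

theorem sum_pow_mul_le_two_mul {r c M : ℝ} (hr : 2 ≤ r) (hc : 0 ≤ c) (hM : 0 ≤ M) {s : Finset ℕ}
    (hs : ∀ i ∈ s, r ^ i * c ≤ M) : ∑ i ∈ s, r ^ i * c ≤ 2 * M := by
  have hr0 : 0 ≤ r := by linarith
  rcases s.eq_empty_or_nonempty with rfl | hne
  · simpa using hM
  have hgeom (m : ℕ) : ∑ i ∈ Finset.range (m + 1), r ^ i ≤ 2 * r ^ m := by
    induction m with
    | zero => simp
    | succ m ih =>
      rw [Finset.sum_range_succ]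
      have hstep : 2 * r ^ m ≤ r ^ (m + 1) := by
        rw [pow_succ']
        gcongr
      linarith
  calc ∑ i ∈ s, r ^ i * c = (∑ i ∈ s, r ^ i) * c := (Finset.sum_mul ..).symm
    _ ≤ (∑ i ∈ Finset.range (s.max' hne + 1), r ^ i) * c := by
        gcongr
        exact fun i hi => Finset.mem_range_succ_iff.2 (s.le_max' i hi)
    _ ≤ 2 * r ^ s.max' hne * c := by gcongr; exact hgeom _
    _ ≤ 2 * M := by linarith [hs _ (s.max'_mem hne)]

theorem sum_pow_mul_le_four_mul {r w M : ℝ} (hr : 2 ≤ r) (hw : 2 ≤ w) (hM : 0 ≤ M) {c : ℕ → ℝ}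
    (hc : ∀ t, 0 ≤ c t) {s : Finset (ℕ × ℕ)} (hs : ∀ x ∈ s, r ^ x.1 * c x.2 ≤ M / w ^ x.2) :
    ∑ x ∈ s, r ^ x.1 * c x.2 ≤ 4 * M := by
  have hfiber (t : ℕ) : ∑ x ∈ s with x.2 = t, r ^ x.1 * c x.2 ≤ 2 * (M / w ^ t) := by
    have hinj : Set.InjOn Prod.fst (s.filter fun x => x.2 = t : Set (ℕ × ℕ)) := fun x hx y hy h =>
      Prod.ext h (((Finset.mem_filter.1 hx).2).trans (Finset.mem_filter.1 hy).2.symm)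
    calc ∑ x ∈ s with x.2 = t, r ^ x.1 * c x.2
        = ∑ x ∈ s with x.2 = t, r ^ x.1 * c t :=
          Finset.sum_congr rfl fun x hx => by rw [(Finset.mem_filter.1 hx).2]
      _ = ∑ i ∈ (s.filter fun x => x.2 = t).image Prod.fst, r ^ i * c t :=
          (Finset.sum_image (f := fun i => r ^ i * c t) hinj).symm
      _ ≤ 2 * (M / w ^ t) := by
          refine sum_pow_mul_le_two_mul hr (hc t) (by positivity) ?_
          simp only [Finset.forall_mem_image, Finset.mem_filter]
          rintro x ⟨hx, rfl⟩
          exact hs x hx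
  calc ∑ x ∈ s, r ^ x.1 * c x.2
      = ∑ t ∈ s.image Prod.snd, ∑ x ∈ s with x.2 = t, r ^ x.1 * c x.2 :=
        (Finset.sum_fiberwise_of_maps_to (fun x hx => Finset.mem_image_of_mem _ hx) _).symm
    _ ≤ ∑ t ∈ s.image Prod.snd, 2 * M * (1 / 2) ^ t := by
        refine Finset.sum_le_sum fun t _ => (hfiber t).trans ?_
        rw [mul_assoc, div_eq_mul_inv, ← inv_pow, one_div]
        gcongr
    _ = 2 * M * ∑ t ∈ s.image Prod.snd, (1 / 2 : ℝ) ^ t := (Finset.mul_sum ..).symm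
    _ ≤ 2 * M * 2 := by
        gcongr
        exact sum_le_hasSum _ (fun _ _ => by positivity) hasSum_geometric_two
    _ = 4 * M := by ring

theorem sum_dyadic_le {w z N : ℝ} (hw : 2 ≤ w) (hz : 0 ≤ z) (hN : 0 < N) {s : Finset (ℕ × ℕ)}
    (hs : ∀ x ∈ s, w ^ x.1 * w ^ (x.1 + x.2) ≤ z ^ 2) :
    ∑ x ∈ s, ((w ^ x.1) ^ 4 / w ^ (x.1 + x.2) + (w ^ x.1) ^ 3 * w ^ (x.1 + x.2) / N) ≤
      4 * (z ^ 3 + z ^ 4 / N) := by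
  have hw1 : 1 ≤ w := one_le_two.trans hw
  have hfst : ∑ x ∈ s, (w ^ 3) ^ x.1 * (w ^ x.2)⁻¹ ≤ 4 * z ^ 3 := by
    refine sum_pow_mul_le_four_mul (c := fun t => (w ^ t)⁻¹) (M := z ^ 3)
      (hw.trans (le_self_pow₀ hw1 three_ne_zero)) hw (by positivity) (fun t => by positivity)
      fun x hx => ?_
    have hle : w ^ x.1 ≤ z := by
      refine (pow_le_pow_iff_left₀ (by positivity) hz two_ne_zero).1 (le_trans ?_ (hs x hx))
      rw [sq]
      gcongr
      exact Nat.le_add_right _ _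
    rw [div_eq_mul_inv, pow_right_comm]
    gcongr
  have hsnd : ∑ x ∈ s, (w ^ 4) ^ x.1 * (w ^ x.2 / N) ≤ 4 * (z ^ 4 / N) := by
    refine sum_pow_mul_le_four_mul (c := fun t => w ^ t / N) (M := z ^ 4 / N)
      (hw.trans (le_self_pow₀ hw1 four_ne_zero)) hw (by positivity) (fun t => by positivity)
      fun x hx => ?_
    rw [le_div_iff₀ (by positivity)]
    calc (w ^ 4) ^ x.1 * (w ^ x.2 / N) * w ^ x.2 = (w ^ x.1 * w ^ (x.1 + x.2)) ^ 2 / N := by ring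
      _ ≤ (z ^ 2) ^ 2 / N := by gcongr; exact hs x hx
      _ = z ^ 4 / N := by ring
  calc ∑ x ∈ s, ((w ^ x.1) ^ 4 / w ^ (x.1 + x.2) + (w ^ x.1) ^ 3 * w ^ (x.1 + x.2) / N)
      = ∑ x ∈ s, (w ^ 3) ^ x.1 * (w ^ x.2)⁻¹ + ∑ x ∈ s, (w ^ 4) ^ x.1 * (w ^ x.2 / N) := by
        rw [← Finset.sum_add_distrib]
        refine Finset.sum_congr rfl fun x _ => ?_
        rw [pow_add]
        field_simp
        ring
    _ ≤ 4 * (z ^ 3 + z ^ 4 / N) := by linarith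

section Families

variable {k : Type*} [Field k] [NumberField k] {Q : Finset (Ideal (𝓞 k))}

theorem card_le_of_pairwiseDisjoint {σ : Type*} (hQ : ∀ p ∈ Q, Prime p)
    (h3 : ∀ p ∈ Q, (3 : 𝓞 k) ∉ p) {J : Finset σ} {F : σ → Finset (Cubic (𝓞 k))}
    (hF : (J : Set σ).PairwiseDisjoint F) {C x y : ℝ} (hC : 1 ≤ C) (hx : 1 ≤ x) (hy : 1 ≤ y)
    (hcard : ∀ s ∈ J, (y / x) ^ finrank ℚ k ≤ C * (F s).card)
    (h0 : ∀ s ∈ J, ∀ P ∈ F s, P.a ≠ 0)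
    (hbox : ∀ s ∈ J, ∀ P ∈ F s, CoeffHouseLE P (coeffBox C x y))
    (hdiscr : ∀ s ∈ J, ∀ P ∈ F s, ∀ p ∈ Q, P.a ∈ p ∨ P.discr ∈ p) :
    (J.card : ℝ) ≤ 8 * 256 ^ finrank ℚ k * C ^ (4 * finrank ℚ k + 1) * 4 ^ Q.card *
      ((x ^ finrank ℚ k) ^ 4 / y ^ finrank ℚ k +
        (x ^ finrank ℚ k) ^ 3 * y ^ finrank ℚ k / Ideal.absNorm (∏ p ∈ Q, p)) := by
  classical
  set n := finrank ℚ k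
  set N := (Ideal.absNorm (∏ p ∈ Q, p) : ℝ) with hN
  have hN0 : 0 < N := zero_lt_one.trans_le (one_le_absNorm_prod hQ)
  have hx0 : 0 < x := zero_lt_one.trans_le hx
  have hy0 : 0 < y := zero_lt_one.trans_le hy
  have hC0 : 0 < C := zero_lt_one.trans_le hC
  have hmem {p : Cubic (𝓞 k) → Prop} (h : ∀ s ∈ J, ∀ P ∈ F s, p P) : ∀ P ∈ J.biUnion F, p P :=
    fun P hP => by
      obtain ⟨s, hs, hPs⟩ := Finset.mem_biUnion.1 hP
      exact h s hs P hPs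
  have hT := card_le_of_coeffHouseLE hQ h3 (J.biUnion F) (H := coeffBox C x y)
    (mul_nonneg hC0.le (by positivity)) (one_le_mul_of_one_le_of_one_le hC hx)
    (one_le_mul_of_one_le_of_one_le hC hy) (mul_nonneg hC0.le (by positivity))
    (hmem h0) (hmem hbox) (hmem hdiscr)
  have hsum : J.card * (y / x) ^ n ≤ C * (J.biUnion F).card := by
    rw [Finset.card_biUnion hF, Nat.cast_sum, Finset.mul_sum, ← nsmul_eq_mul]
    exact Finset.card_nsmul_le_sum _ _ _ hcard
  have habc : C * (x ^ 2 / y) * (C * x) * (C * y) = C ^ 3 * x ^ 3 := by field_simp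
  rw [← le_div_iff₀ (by positivity)] at hsum
  simp only [coeffBox, habc, ← hN] at hT
  have hd : 1 + (C * (y ^ 2 / x)) ^ n / N ≤ C ^ n * (1 + (y ^ 2 / x) ^ n / N) := by
    rw [mul_pow, mul_div_assoc, mul_add, mul_one]
    gcongr
    exact one_le_pow₀ hC
  calc (J.card : ℝ) ≤ C * (J.biUnion F).card / (y / x) ^ n := hsum
    _ ≤ C * (8 * 256 ^ n * 4 ^ Q.card * (C ^ 3 * x ^ 3) ^ n *
          (C ^ n * (1 + (y ^ 2 / x) ^ n / N))) / (y / x) ^ n := by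
        gcongr
        refine hT.trans ?_
        gcongr
    _ = _ := by
        simp only [mul_pow, div_pow]
        field_simp
        ring

theorem card_le_of_pairwiseDisjoint_dyadic {σ : Type*} (hQ : ∀ p ∈ Q, Prime p)
    (h3 : ∀ p ∈ Q, (3 : 𝓞 k) ∉ p) {J : Finset σ} {F : σ → Finset (Cubic (𝓞 k))} {i t : σ → ℕ}
    (hF : (J : Set σ).PairwiseDisjoint F) {C z : ℝ} (hC : 1 ≤ C) (hz : 0 ≤ z)
    (hvol : ∀ s ∈ J, ((2 : ℝ) ^ i s * 2 ^ (i s + t s)) ^ finrank ℚ k ≤ z ^ 2)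
    (hcard : ∀ s ∈ J, ((2 : ℝ) ^ (i s + t s) / 2 ^ i s) ^ finrank ℚ k ≤ C * (F s).card)
    (h0 : ∀ s ∈ J, ∀ P ∈ F s, P.a ≠ 0)
    (hbox : ∀ s ∈ J, ∀ P ∈ F s, CoeffHouseLE P (coeffBox C (2 ^ i s) (2 ^ (i s + t s))))
    (hdiscr : ∀ s ∈ J, ∀ P ∈ F s, ∀ p ∈ Q, P.a ∈ p ∨ P.discr ∈ p) :
    (J.card : ℝ) ≤ 8 * 256 ^ finrank ℚ k * C ^ (4 * finrank ℚ k + 1) * 4 ^ Q.card *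
      (4 * (z ^ 3 + z ^ 4 / Ideal.absNorm (∏ p ∈ Q, p))) := by
  classical
  set n := finrank ℚ k
  set N := (Ideal.absNorm (∏ p ∈ Q, p) : ℝ)
  set w : ℝ := 2 ^ n
  have hpow (m : ℕ) : ((2 : ℝ) ^ m) ^ n = w ^ m := pow_right_comm ..
  have hfiber (x : ℕ × ℕ) : ((J.filter fun s => (i s, t s) = x).card : ℝ) ≤
      8 * 256 ^ n * C ^ (4 * n + 1) * 4 ^ Q.card *
        ((w ^ x.1) ^ 4 / w ^ (x.1 + x.2) + (w ^ x.1) ^ 3 * w ^ (x.1 + x.2) / N) := by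
    have hmem : ∀ s ∈ J.filter fun s => (i s, t s) = x, s ∈ J ∧ i s = x.1 ∧ t s = x.2 := by
      simp +contextual [Prod.ext_iff]
    simp only [← hpow]
    refine card_le_of_pairwiseDisjoint hQ h3
      (hF.subset (Finset.coe_subset.2 (Finset.filter_subset _ _))) hC (one_le_pow₀ one_le_two)
      (one_le_pow₀ one_le_two) (fun s hs => ?_) (fun s hs => h0 s (hmem s hs).1)
      (fun s hs => ?_) fun s hs => hdiscr s (hmem s hs).1
    all_goals obtain ⟨hs, hi, ht⟩ := hmem s hs
    · simpa only [hi, ht] using hcard s hs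
    · simpa only [hi, ht] using hbox s hs
  have hsum := sum_dyadic_le (w := w) (le_self_pow₀ one_le_two finrank_pos.ne') hz
    (zero_lt_one.trans_le (one_le_absNorm_prod hQ)) (s := J.image fun s => (i s, t s))
    (Finset.forall_mem_image.2 fun s hs => by simpa only [mul_pow, hpow] using hvol s hs)
  rw [Finset.card_eq_sum_card_image (fun s => (i s, t s)) J, Nat.cast_sum]
  refine (Finset.sum_le_sum fun x _ => hfiber x).trans ?_
  rw [← Finset.mul_sum]
  gcongr

end Families

end Summation

/-! ### Counting cubic extensions -/

section CubicFamilies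

open Module

theorem pairwiseDisjoint_of_isCubicGenerator {k : Type*} [Field k]
    {J : Finset (CubicExtension k)} (hJ : Set.InjOn (Quotient.mk (CubicExtension.instSetoid k)) J)
    {F : CubicExtension k → Finset (Cubic (𝓞 k))}
    (hF : ∀ K : CubicExtension k, ∀ P ∈ F K, ∃ ρ : K.1,
      IsCubicGenerator (P.map (algebraMap (𝓞 k) k)) ρ) :
    (J : Set (CubicExtension k)).PairwiseDisjoint F := fun K hK L hL hne => by
  refine Finset.disjoint_left.2 fun P hPK hPL => hne (hJ hK hL (Quotient.sound ?_))
  obtain ⟨ρ, hρ⟩ := hF K P hPK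
  obtain ⟨σ, hσ⟩ := hF L P hPL
  exact hρ.nonempty_algEquiv K.2 L.2 hσ

theorem exists_card_le_of_isRamifiedAt (k : Type*) [Field k] [NumberField k] :
    ∃ C : ℝ, 1 ≤ C ∧ ∀ Q : Finset (Ideal (𝓞 k)), (∀ p ∈ Q, Prime p) →
      (∀ p ∈ Q, (3 : 𝓞 k) ∉ p) → ∀ X : ℝ, 0 ≤ X → ∀ J : Finset (CubicExtension k),
        Set.InjOn (Quotient.mk (CubicExtension.instSetoid k)) J →
        (∀ K ∈ J, |(discr K.1 : ℝ)| ≤ X) → (∀ K ∈ J, ∀ p ∈ Q, IsRamifiedAt k K.1 p) →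
        (J.card : ℝ) ≤
          C * 4 ^ Q.card * (X ^ (3 / 4 : ℝ) + X / Ideal.absNorm (∏ p ∈ Q, p)) := by
  obtain ⟨C, hC, hfamily⟩ := exists_dyadic_finset_isCubicGenerator k
  choose i t hvol F hcard hF using fun K : CubicExtension k => hfamily K.1 K.2
  set B : ℝ := 8 * 256 ^ finrank ℚ k * C ^ (4 * finrank ℚ k + 1)
  have hB : 1 ≤ B := one_le_mul_of_one_le_of_one_le
    (one_le_mul_of_one_le_of_one_le (by norm_num) (one_le_pow₀ (by norm_num))) (one_le_pow₀ hC)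
  refine ⟨B * (4 * C ^ 4), one_le_mul_of_one_le_of_one_le hB
    (one_le_mul_of_one_le_of_one_le (by norm_num) (one_le_pow₀ hC)), ?_⟩
  intro Q hQ h3 X hX J hJ hdisc hram
  have hroot (m : ℕ) : (X ^ (1 / 4 : ℝ)) ^ m = X ^ (m / 4 : ℝ) := by
    rw [← Real.rpow_mul_natCast hX, one_div_mul_eq_div]
  have hvol' : ∀ K ∈ J, ((2 : ℝ) ^ i K * 2 ^ (i K + t K)) ^ finrank ℚ k ≤
      (C * X ^ (1 / 4 : ℝ)) ^ 2 := fun K hK => by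
    calc _ ≤ C * √|(discr K.1 : ℝ)| := hvol K
      _ ≤ C ^ 2 * √X := by
          gcongr
          · exact le_self_pow₀ hC two_ne_zero
          · exact hdisc K hK
      _ = (C * X ^ (1 / 4 : ℝ)) ^ 2 := by
          rw [mul_pow, hroot, Real.sqrt_eq_rpow]
          norm_num
  have hcount := card_le_of_pairwiseDisjoint_dyadic hQ h3
    (pairwiseDisjoint_of_isCubicGenerator hJ fun K P hP => (hF K P hP).2) hC (by positivity) hvol'
    (fun K _ => hcard K) (fun K _ P hP => (hF K P hP).2.choose_spec.a_ne_zero)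
    (fun K _ P hP => (hF K P hP).1) fun K hK P hP p hp => by
      have : p.IsMaximal := (Ideal.isPrime_of_prime (hQ p hp)).isMaximal (hQ p hp).ne_zero
      exact (hF K P hP).2.choose_spec.leadingCoeff_mem_or_discr_mem K.2 (hQ p hp).ne_zero
        (hram K hK p hp)
  simp only [mul_pow, hroot, Nat.cast_ofNat, div_self (four_ne_zero' ℝ), Real.rpow_one] at hcount
  calc (J.card : ℝ) ≤ B * 4 ^ Q.card *
          (4 * (C ^ 3 * X ^ (3 / 4 : ℝ) + C ^ 4 * X / Ideal.absNorm (∏ p ∈ Q, p))) := hcount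
    _ ≤ B * 4 ^ Q.card *
          (4 * (C ^ 4 * X ^ (3 / 4 : ℝ) + C ^ 4 * X / Ideal.absNorm (∏ p ∈ Q, p))) := by
        gcongr
        norm_num
    _ = _ := by ring

end CubicFamilies

section Ideals

open Module UniqueFactorizationMonoid

theorem exists_finset_prime_prod_eq {R : Type*} [CommRing R] [IsDedekindDomain R] {q : Ideal R}
    (hq : Squarefree q) : ∃ Q : Finset (Ideal R), (∀ p ∈ Q, Prime p) ∧ ∏ p ∈ Q, p = q := by
  classical
  refine ⟨(normalizedFactors q).toFinset,
    fun p hp => prime_of_normalized_factor p (Multiset.mem_toFinset.1 hp), ?_⟩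
  rw [Finset.prod, Multiset.toFinset_val, Multiset.map_id',
    ((squarefree_iff_nodup_normalizedFactors hq.ne_zero).1 hq).dedup]
  exact associated_iff_eq.1 (prod_normalizedFactors hq.ne_zero)

variable {k : Type*} [Field k] [NumberField k] {Q : Finset (Ideal (𝓞 k))}

theorem absNorm_prod_le_three_pow_mul [DecidablePred fun p : Ideal (𝓞 k) => (3 : 𝓞 k) ∉ p]
    (hQ : ∀ p ∈ Q, Prime p) :
    (Ideal.absNorm (∏ p ∈ Q, p) : ℝ) ≤
      3 ^ finrank ℚ k * Ideal.absNorm (∏ p ∈ Q with (3 : 𝓞 k) ∉ p, p) := by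
  classical
  have hmem : (3 : 𝓞 k) ∈ ∏ p ∈ Q with ¬ (3 : 𝓞 k) ∉ p, p :=
    mem_prod_of_forall_mem (fun p hp => hQ p (Finset.mem_filter.1 hp).1)
      fun p hp => not_not.1 (Finset.mem_filter.1 hp).2
  have hhouse : house ((3 : 𝓞 k) : k) = 3 := by
    rw [RingOfIntegers.coe_eq_algebraMap, map_ofNat]
    simpa using house_intCast (K := k) 3
  have hle := absNorm_le_house_pow hmem (OfNat.ofNat_ne_zero 3)
  rw [hhouse] at hle
  rw [← Finset.prod_filter_mul_prod_filter_not Q (fun p => (3 : 𝓞 k) ∉ p), map_mul,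
    Nat.cast_mul, mul_comm]
  gcongr

theorem exists_pow_card_le_mul_absNorm_rpow (k : Type*) [Field k] [NumberField k] {c ε : ℝ}
    (hc : 1 ≤ c) (hε : 0 < ε) :
    ∃ W : ℝ, 1 ≤ W ∧ ∀ Q : Finset (Ideal (𝓞 k)), (∀ p ∈ Q, Prime p) →
      c ^ Q.card ≤ W * (Ideal.absNorm (∏ p ∈ Q, p) : ℝ) ^ ε := by
  classical
  have hc0 : 0 ≤ c := zero_le_one.trans hc
  let B := (Ideal.finite_setOfPred_absNorm_le (S := 𝓞 k) ⌊c ^ ε⁻¹⌋₊).toFinset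
  have hB {p : Ideal (𝓞 k)} (hp : p ∉ B) : c ≤ (Ideal.absNorm p : ℝ) ^ ε := by
    have hlt : c ^ ε⁻¹ < Ideal.absNorm p := Nat.lt_of_floor_lt (by simpa [B] using hp)
    exact (Real.rpow_inv_le_iff_of_pos hc0 (Nat.cast_nonneg _) hε).1 hlt.le
  refine ⟨c ^ B.card, one_le_pow₀ hc, fun Q hQ => ?_⟩
  have hsingle : ∀ p ∈ Q, 1 ≤ (Ideal.absNorm p : ℝ) ^ ε := fun p hp =>
    Real.one_le_rpow (one_le_absNorm_of_ne_zero (hQ p hp).ne_zero) hε.le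
  rw [map_prod, Nat.cast_prod, ← Real.finsetProd_rpow _ _ fun p _ => Nat.cast_nonneg _,
    ← Finset.prod_const]
  calc ∏ _p ∈ Q, c ≤ ∏ p ∈ Q, ((if p ∈ B then c else 1) * (Ideal.absNorm p : ℝ) ^ ε) := by
        refine Finset.prod_le_prod (fun _ _ => hc0) fun p hp => ?_
        split_ifs with hpB
        · exact le_mul_of_one_le_right hc0 (hsingle p hp)
        · exact (hB hpB).trans_eq (one_mul _).symm
    _ = c ^ (Q.filter (· ∈ B)).card * ∏ p ∈ Q, (Ideal.absNorm p : ℝ) ^ ε := by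
        rw [Finset.prod_mul_distrib, ← Finset.prod_filter, Finset.prod_const]
    _ ≤ c ^ B.card * ∏ p ∈ Q, (Ideal.absNorm p : ℝ) ^ ε := by
        gcongr
        exact fun p hp => (Finset.mem_filter.1 hp).2

end Ideals

section IsomorphismClasses

open Module

theorem rpow_add_div_le_mul_div_rpow {X N M B : ℝ} (hN : 1 ≤ N) (hNX : N ≤ X) (hM : 0 < M)
    (hB : 0 ≤ B) (hNM : N ≤ B * M) :
    X ^ (3 / 4 : ℝ) + X / M ≤ (1 + B) * (X / N ^ (1 / 4 : ℝ)) := by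
  have hN0 : 0 < N := one_pos.trans_le hN
  have hX : 0 < X := hN0.trans_le hNX
  have hlarge : X ^ (3 / 4 : ℝ) ≤ X / N ^ (1 / 4 : ℝ) :=
    calc X ^ (3 / 4 : ℝ) = X / X ^ (1 / 4 : ℝ) := by
          rw [← Real.rpow_one_sub' hX.le (by norm_num)]
          norm_num
      _ ≤ X / N ^ (1 / 4 : ℝ) := by gcongr
  have hsmall : X / M ≤ B * (X / N ^ (1 / 4 : ℝ)) :=
    calc X / M ≤ B * (X / N) := by
          rw [mul_div_assoc', div_le_div_iff₀ hM hN0, mul_right_comm, mul_comm X]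
          gcongr
      _ ≤ B * (X / N ^ (1 / 4 : ℝ)) := by
          gcongr
          exact Real.rpow_le_self_of_one_le hN (by norm_num)
  linarith

theorem exists_card_le_of_squarefree (k : Type*) [Field k] [NumberField k] {ε : ℝ} (hε : 0 < ε) :
    ∃ C : ℝ, 0 < C ∧ ∀ q : Ideal (𝓞 k), Squarefree q → ∀ X : ℝ, 0 < X →
      ∀ J : Finset (CubicExtension k),
        Set.InjOn (Quotient.mk (CubicExtension.instSetoid k)) J →
        (∀ K ∈ J, |(discr K.1 : ℝ)| ≤ X) →
        (∀ K ∈ J, ∀ p : Ideal (𝓞 k), p.IsPrime → p ∣ q → IsRamifiedAt k K.1 p) →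
        (J.card : ℝ) ≤ C * X / (Ideal.absNorm q : ℝ) ^ ((1 / 4 : ℝ) - ε) := by
  classical
  obtain ⟨C, hC, hcount⟩ := exists_card_le_of_isRamifiedAt k
  obtain ⟨W, hW, hcard⟩ := exists_pow_card_le_mul_absNorm_rpow k (c := 4) (by norm_num) hε
  refine ⟨C * W * (1 + 3 ^ finrank ℚ k), by positivity, fun q hq X hX J hJ hdisc hram => ?_⟩
  obtain ⟨Q, hQ, rfl⟩ := exists_finset_prime_prod_eq hq
  set N : ℝ := (Ideal.absNorm (∏ p ∈ Q, p) : ℝ)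
  have hN : 1 ≤ N := one_le_absNorm_prod hQ
  have hramQ : ∀ K ∈ J, ∀ p ∈ Q, IsRamifiedAt k K.1 p := fun K hK p hp =>
    hram K hK p (Ideal.isPrime_of_prime (hQ p hp)) (Finset.dvd_prod_of_mem _ hp)
  obtain rfl | ⟨K₀, hK₀⟩ := J.eq_empty_or_nonempty
  · rw [Finset.card_empty, Nat.cast_zero]
    positivity
  have hNX : N ≤ X := by
    refine le_trans ?_ (hdisc K₀ hK₀)
    simpa only [N, map_prod] using prod_absNorm_le_abs_discr hQ (hramQ K₀ hK₀)
  let Q' := Q.filter fun p => (3 : 𝓞 k) ∉ p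
  have hQ'Q : Q' ⊆ Q := Finset.filter_subset _ Q
  have hQ' : ∀ p ∈ Q', Prime p := fun p hp => hQ p (hQ'Q hp)
  calc (J.card : ℝ)
      ≤ C * 4 ^ Q'.card * (X ^ (3 / 4 : ℝ) + X / Ideal.absNorm (∏ p ∈ Q', p)) :=
        hcount Q' hQ' (fun p hp => (Finset.mem_filter.1 hp).2) X hX.le J hJ hdisc
          fun K hK p hp => hramQ K hK p (hQ'Q hp)
    _ ≤ C * (W * N ^ ε) * ((1 + 3 ^ finrank ℚ k) * (X / N ^ (1 / 4 : ℝ))) := by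
        gcongr
        · exact (pow_le_pow_right₀ (by norm_num) (Finset.card_le_card hQ'Q)).trans (hcard Q hQ)
        · exact rpow_add_div_le_mul_div_rpow hN hNX (one_pos.trans_le (one_le_absNorm_prod hQ'))
            (by positivity) (absNorm_prod_le_three_pow_mul hQ)
    _ = C * W * (1 + 3 ^ finrank ℚ k) * X / N ^ ((1 / 4 : ℝ) - ε) := by
        rw [Real.rpow_sub (one_pos.trans_le hN)]
        field_simp

theorem finite_image_and_ncard_image_le {α β : Type*} {f : α → β} {S : Set α} {B : ℝ}
    (h : ∀ J : Finset α, ↑J ⊆ S → Set.InjOn f J → (J.card : ℝ) ≤ B) :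
    (f '' S).Finite ∧ ((f '' S).ncard : ℝ) ≤ B := by
  obtain ⟨T, hTS, hT⟩ := Set.exists_subset_bijOn S f
  have hfin : T.Finite := by
    by_contra hinf
    obtain ⟨J, hJT, hJ⟩ := Set.Infinite.exists_subset_card_eq hinf (⌊B⌋₊ + 1)
    have := h J (hJT.trans hTS) (hT.injOn.mono hJT)
    rw [hJ] at this
    exact (Nat.lt_floor_add_one B).not_ge (mod_cast this)
  lift T to Finset α using hfin
  rw [← hT.image_eq, hT.injOn.ncard_image, Set.ncard_coe_finset]
  exact ⟨T.finite_toSet.image f, h T hTS hT.injOn⟩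

/-- The set of `k`-isomorphism classes of cubic extensions `K / k`, cyclic or not, that are
partially or totally ramified at every prime dividing `q` and have `|disc (K / ℚ)| ≤ X`. -/
def ramifiedCubicClasses (k : Type*) [Field k] [NumberField k] (q : Ideal (𝓞 k)) (X : ℝ) :
    Set (Quotient (CubicExtension.instSetoid k)) :=
  Quotient.mk (CubicExtension.instSetoid k) ''
    {K | (∀ p : Ideal (𝓞 k), p.IsPrime → p ∣ q → IsRamifiedAt k K.1 p) ∧ |(discr K.1 : ℝ)| ≤ X}

theorem IsPartiallyRamified.isRamifiedAt {k K : Type*} [Field k] [Field K] [Algebra k K]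
    {p : Ideal (𝓞 k)} (h : IsPartiallyRamified k K p) : IsRamifiedAt k K p :=
  let ⟨P₁, P₂, hP₁, _, _, hmap⟩ := h
  ⟨P₁, hP₁, P₂, hmap⟩

theorem partiallyRamifiedCubicClasses_subset {k : Type*} [Field k] [NumberField k]
    (q : Ideal (𝓞 k)) (X : ℝ) :
    partiallyRamifiedCubicClasses k q X ⊆ ramifiedCubicClasses k q X :=
  Set.image_mono fun _ hK => ⟨fun p hp hpq => (hK.2.1 p hp hpq).isRamifiedAt, hK.2.2⟩

end IsomorphismClasses

theorem theorem3p2_general (k : Type*) [Field k] [NumberField k] (ε : ℝ) (hε : 0 < ε) :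
    ∃ C : ℝ, 0 < C ∧ ∀ q : Ideal (𝓞 k), Squarefree q → ∀ X : ℝ, 0 < X →
      (ramifiedCubicClasses k q X).Finite ∧
      ((ramifiedCubicClasses k q X).ncard : ℝ) ≤
        C * X / (Ideal.absNorm q : ℝ) ^ ((1 / 4 : ℝ) - ε) := by
  obtain ⟨C, hC, hcard⟩ := exists_card_le_of_squarefree k hε
  exact ⟨C, hC, fun q hq X hX => finite_image_and_ncard_image_le fun J hJS hJ =>
    hcard q hq X hX J hJ (fun K hK => (hJS hK).2) fun K hK => (hJS hK).1⟩

theorem theorem3p2 (k : Type*) [Field k] [NumberField k] (ε : ℝ) (hε : 0 < ε) :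
    ∃ C : ℝ, 0 < C ∧ ∀ q : Ideal (𝓞 k), Squarefree q → ∀ X : ℝ, 0 < X →
      (partiallyRamifiedCubicClasses k q X).Finite ∧
      ((partiallyRamifiedCubicClasses k q X).ncard : ℝ) ≤
        C * X / (Ideal.absNorm q : ℝ) ^ ((1 / 6 : ℝ) - ε) := by
  obtain ⟨C, hC, hgeneral⟩ := theorem3p2_general k ε hε
  refine ⟨C, hC, fun q hq X hX => ?_⟩
  obtain ⟨hfin, hcard⟩ := hgeneral q hq X hX
  have hsub := partiallyRamifiedCubicClasses_subset q X
  have hq1 := one_le_absNorm_of_ne_zero hq.ne_zero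
  refine ⟨hfin.subset hsub, (Nat.cast_le.2 (Set.ncard_le_ncard hsub hfin)).trans
    (hcard.trans ?_)⟩
  gcongr
  norm_num
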